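/- Let $K,d\ge 1$ be integers and $\mathcal Y=\{1,\dots,K\}^d$, where the token $K$ is the mask; let $\mathrm{numK}(y)$ be the number of coordinates of $y\in\mathcal Y$ equal to $K$. Let $q_*$ be a probability distribution on $\mathcal Y$ that gives probability zero to every $y$ with $\mathrm{numK}(y)>0$. *Forward and reverse process.* Let $R^{\to}(y,y')$ be the rate of jumping from $y'$ to $y$: for $y\ne y'$ it is $1$ if $y$ and $y'$ differ in exactly one coordinate and $y$ has the mask there, and $0$ otherwise; $R^{\to}(y',y')=-(d-\mathrm{numK}(y'))$. Let $q_t=e^{tR^{\to}}q_*$ be the law at time $t$ of the continuous-time Markov chain with these rates started from $q_*$. For a horizon $T>0$ and $t\in[0,T)$ put $v_{t,y'}(y)=q_{T-t}(y)/q_{T-t}(y')$. Let $\tilde v_{t,y'}(y)\ge 0$ be an estimated score (measurable in $t$), with score entropy error $$L_{SE}(\tilde v)=\frac1T\int_0^T\mathbb E_{y\sim q_t}\Big[\sum_{y'\neq y}R^{\to}(y,y')\,D_\phi\big(v_{T-t,y}(y')\,\|\,\tilde v_{T-t,y}(y')\big)\Big]dt,\qquad D_\phi(a\|b)=a\ln\tfrac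 ab-a+b,$$ where $D_\phi(0\|b)=b$ for every $b\ge 0$ and $D_\phi(a\|0)=\infty$ for $a>0$. *Sampler (Mask-Aware Truncated Uniformization).* Put $\tilde R_t(y,y')=R^{\to}(y',y)\,\tilde v_{t,y'}(y)$ for $y\neq y'$ and $\tilde R_t(y')=\sum_{y\ne y'}\tilde R_t(y,y')$. Given $0=t_0<\dots<t_W=T-\delta$, start from $\hat y_{t_0}=(K,\dots,K)$. For $w=1,\dots,W$: let $\beta=K\,\mathrm{numK}(\hat y_{t_{w-1}})/(e^{T-t_w}-1)$; draw $N_w\sim\mathrm{Poisson}(\beta(t_w-t_{w-1}))$ and $N_w$ i.i.d. uniform points of $[t_{w-1},t_w]$, sorted as $\tau_1<\dots<\tau_{N_w}$; let $z_0=\hat y_{t_{w-1}}$; for $n=1,\dots,N_w$ make one score evaluation and let $z_n=y$ with probability $\beta^{-1}\hat R_{\tau_n}(y,z_{n-1})$ for each $y\neq z_{n-1}$, and $z_n=z_{n-1}$ with the remaining probability, where $\hat R_\tau(y,y')=\tilde R_\tau(y,y')\,\min\{1,\beta/\tilde R_\tau(y')\}$ (and $\hat R_\tau(y,y')=\tilde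 R_\tau(y,y')$ if $\tilde R_\tau(y')=0$); let $\hat y_{t_w}=z_{N_w}$. The output is $\hat y_{t_W}$, with law $\hat p$, and the number of score evaluations is $\sum_{w=1}^W N_w$. **Theorem.** Let $0<\epsilon<1$, $T=\ln(4d/\epsilon^2)$, $\eta=\epsilon/(2d)$, $\eta\le\delta\le\epsilon/d$, and suppose that $W=(T-\delta)/\eta$ is an integer and $t_w-t_{w-1}=\eta$ for all $w\in\{1,\dots,W\}$. Suppose that $L_{SE}(\tilde v)\le\epsilon_{\rm score}^2$ with $0\le\epsilon_{\rm score}\le T^{-1/2}\epsilon$. Then $$\mathrm{TV}(q_*,\hat p)\le 2\epsilon\qquad\text{and}\qquad \mathbb E\Big[\sum_{w=1}^W N_w\Big]\le 2K\Big(d-\frac{\epsilon^2}{4}\Big)+12Kd\ln d .$$ -/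

import Mathlib

open MeasureTheory ProbabilityTheory
open scoped NNReal ENNReal

noncomputable section

namespace MATU

/-- Token sequences of length `d` over a vocabulary of `K` tokens. -/
abbrev Seq (K d : ℕ) : Type := Fin d → Fin K

/-- The mask token: the last one of the `K` tokens. -/
def mask (K : ℕ) [NeZero K] : Fin K := ⟨K - 1, Nat.sub_lt (NeZero.pos K) Nat.one_pos⟩

/-- The number of mask tokens in a sequence. -/
def numMask {K d : ℕ} [NeZero K] (y : Seq K d) : ℕ :=
  (Finset.univ.filter fun i => y i = mask K).card

/-- The absorbing forward transition rate `R (y, y')`, from `y'` to `y`: each unmasked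
coordinate becomes the mask at rate one. The diagonal makes the columns sum to zero. -/
def fwdRate {K d : ℕ} [NeZero K] (y y' : Seq K d) : ℝ≥0 :=
  if hammingDist y y' = 1 ∧ ∀ i, y i ≠ y' i → y i = mask K then 1 else 0

/-- The generator matrix of the forward process (rate from the column state to the row state). -/
def fwdGen (K d : ℕ) [NeZero K] : Matrix (Seq K d) (Seq K d) ℝ :=
  fun y y' => if y = y' then -∑ i, (if y i = mask K then 0 else 1) else (fwdRate y y' : ℝ)

/-- The marginal law at time `t` of the forward continuous-time Markov chain started at `q`. -/
def fwdMarginal {K d : ℕ} [NeZero K] (q : PMF (Seq K d)) (t : ℝ) : Seq K d → ℝ :=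
  (NormedSpace.exp (t • fwdGen K d)).mulVec fun y => (q y).toReal

/-- The marginal law at time `t` of the reverse process with horizon `T`. -/
def revMarginal {K d : ℕ} [NeZero K] (q : PMF (Seq K d)) (T t : ℝ) : Seq K d → ℝ :=
  fwdMarginal q (T - t)

/-- The discrete score `v_{t, y'} (y)`, a density ratio of the reverse marginal. -/
def trueScore {K d : ℕ} [NeZero K] (q : PMF (Seq K d)) (T t : ℝ) (y' y : Seq K d) : ℝ :=
  revMarginal q T t y / revMarginal q T t y'

/-- The Bregman divergence `φ u - φ v - φ' v (u - v)` of `φ c = c log c` for `u, v ≥ 0`,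
extended by its limits to `v = 0`. -/
def bregman (u : ℝ) (v : ℝ≥0) : ℝ≥0∞ :=
  if v = 0 then (if u = 0 then 0 else ⊤)
  else ENNReal.ofReal
    (u * Real.log u - (v : ℝ) * Real.log v - (Real.log v + 1) * (u - v))

/-- The score entropy loss of an estimated score `v`, where `v t y' y` estimates the density
ratio `v_{t, y'} (y)` at the reverse time `t`. -/
def scoreEntropy {K d : ℕ} [NeZero K] (q : PMF (Seq K d)) (T : ℝ)
    (v : ℝ → Seq K d → Seq K d → ℝ≥0) : ℝ≥0∞ :=
  (ENNReal.ofReal T)⁻¹ * ∫⁻ t in Set.Icc 0 T,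
    ∑ y, ENNReal.ofReal (fwdMarginal q t y) *
      ∑ y' ∈ Finset.univ.filter (fun y' => y' ≠ y),
        (fwdRate y y' : ℝ≥0∞) * bregman (trueScore q T (T - t) y y') (v (T - t) y y')

/-- The estimated reverse rate from `y'` to `y` at time `t`, for `y ≠ y'`. -/
def estRate {K d : ℕ} [NeZero K] (v : ℝ → Seq K d → Seq K d → ℝ≥0) (t : ℝ)
    (y y' : Seq K d) : ℝ≥0 :=
  fwdRate y' y * v t y' y

/-- The total estimated rate out of `y'`. -/
def estOut {K d : ℕ} [NeZero K] (v : ℝ → Seq K d → Seq K d → ℝ≥0) (t : ℝ)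
    (y' : Seq K d) : ℝ≥0 :=
  ∑ y ∈ Finset.univ.filter (fun y => y ≠ y'), estRate v t y y'

/-- The threshold `β_t (y) = K numMask(y) / (e ^ (T - t) - 1)`. -/
def beta {K d : ℕ} [NeZero K] (T t : ℝ) (y : Seq K d) : ℝ≥0 :=
  Real.toNNReal ((K : ℝ) * numMask y / (Real.exp (T - t) - 1))

/-- The reverse rate from `y'` to `y`, for `y ≠ y'`, truncated at total outgoing rate `β`. -/
def truncRate {K d : ℕ} [NeZero K] (v : ℝ → Seq K d → Seq K d → ℝ≥0) (β : ℝ≥0) (t : ℝ)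
    (y y' : Seq K d) : ℝ≥0 :=
  if β < estOut v t y' then estRate v t y y' * β / estOut v t y' else estRate v t y y'

/-- The total truncated rate out of `y'`. -/
def truncOut {K d : ℕ} [NeZero K] (v : ℝ → Seq K d → Seq K d → ℝ≥0) (β : ℝ≥0) (t : ℝ)
    (y' : Seq K d) : ℝ≥0 :=
  ∑ y ∈ Finset.univ.filter (fun y => y ≠ y'), truncRate v β t y y'

theorem truncOut_le {K d : ℕ} [NeZero K] (v : ℝ → Seq K d → Seq K d → ℝ≥0) (β : ℝ≥0) (t : ℝ)
    (y' : Seq K d) : truncOut v β t y' ≤ β := by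
  unfold truncOut truncRate
  by_cases h : β < estOut v t y'
  · have h0 : estOut v t y' ≠ 0 := (pos_of_gt h).ne'
    simp only [h, if_true]
    rw [← Finset.sum_div, ← Finset.sum_mul]
    change estOut v t y' * β / estOut v t y' ≤ β
    rw [mul_div_cancel_left₀ _ h0]
  · simp only [h, if_false]
    exact not_lt.mp h

/-- The probability that an iteration at time `τ` moves `z` to `z'`: `β⁻¹` times the truncated
rate for `z' ≠ z`, and the remaining mass for `z' = z`. -/
def stepProb {K d : ℕ} [NeZero K] (v : ℝ → Seq K d → Seq K d → ℝ≥0) (β : ℝ≥0) (τ : ℝ)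
    (z z' : Seq K d) : ℝ≥0 :=
  if z' = z then 1 - β⁻¹ * truncOut v β τ z else β⁻¹ * truncRate v β τ z' z

theorem sum_stepProb {K d : ℕ} [NeZero K] (v : ℝ → Seq K d → Seq K d → ℝ≥0) (β : ℝ≥0)
    (τ : ℝ) (z : Seq K d) : ∑ z', (stepProb v β τ z z' : ℝ≥0∞) = 1 := by
  have h1 : β⁻¹ * truncOut v β τ z ≤ 1 := by
    rcases eq_or_ne β 0 with rfl | h
    · simp
    · calc β⁻¹ * truncOut v β τ z ≤ β⁻¹ * β := by gcongr; exact truncOut_le v β τ z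
        _ = 1 := inv_mul_cancel₀ h
  have h2 : ∑ z', stepProb v β τ z z' = 1 := by
    rw [← Finset.sum_filter_add_sum_filter_not Finset.univ (fun z' => z' = z)]
    have h3 : ∑ z' ∈ Finset.univ.filter (fun z' => ¬ z' = z), stepProb v β τ z z' =
        β⁻¹ * truncOut v β τ z := by
      unfold truncOut
      rw [Finset.mul_sum]
      refine Finset.sum_congr rfl fun x hx => ?_
      have hx' : x ≠ z := by simpa using hx
      simp [stepProb, hx']
    have h4 : ∑ z' ∈ Finset.univ.filter (fun z' => z' = z), stepProb v β τ z z' =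
        1 - β⁻¹ * truncOut v β τ z := by
      simp [Finset.filter_eq', stepProb]
    rw [h3, h4, tsub_add_cancel_of_le h1]
  rw [← ENNReal.ofNNReal_finsetSum, h2, ENNReal.coe_one]

/-- One iteration (one score evaluation) of the sampler, at time `τ` and from the state `z`. -/
def step {K d : ℕ} [NeZero K] (v : ℝ → Seq K d → Seq K d → ℝ≥0) (β : ℝ≥0) (τ : ℝ)
    (z : Seq K d) : PMF (Seq K d) :=
  PMF.ofFintype (fun z' => (stepProb v β τ z z' : ℝ≥0∞)) (sum_stepProb v β τ z)

/-- The iterations at the successive times of a list. -/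
def run {K d : ℕ} [NeZero K] (v : ℝ → Seq K d → Seq K d → ℝ≥0) (β : ℝ≥0) :
    List ℝ → Seq K d → PMF (Seq K d)
  | [], z => PMF.pure z
  | τ :: l, z => (step v β τ z).bind (run v β l)

/-- The time segment `[a, b]` of the sampler with horizon `T`. The state is a pair: the current
sequence and the number of iterations (score evaluations) made so far. A number `n` is drawn from
the Poisson law, then `n` independent uniform times, which are sorted and run through. -/
def segment {K d : ℕ} [NeZero K] (v : ℝ → Seq K d → Seq K d → ℝ≥0) (T a b : ℝ)
    (x : Seq K d × ℕ) : Measure (Seq K d × ℕ) :=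
  (poissonMeasure (beta T b x.1 * Real.toNNReal (b - a))).bind fun n =>
    (Measure.pi fun _ : Fin n => (volume : Measure ℝ)[|Set.Icc a b]).bind fun u =>
      ((run v (beta T b x.1) (List.ofFn (u ∘ Tuple.sort u)) x.1).map
        fun z => (z, x.2 + n)).toMeasure

/-- The joint law of the state and of the number of iterations after `w` segments of the
partition `p 0 < p 1 < …`, started from the all-mask sequence. -/
def samplerLaw {K d : ℕ} [NeZero K] (v : ℝ → Seq K d → Seq K d → ℝ≥0) (T : ℝ) (p : ℕ → ℝ) :
    ℕ → Measure (Seq K d × ℕ)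
  | 0 => Measure.dirac (fun _ => mask K, 0)
  | w + 1 => (samplerLaw v T p w).bind (segment v T (p w) (p (w + 1)))

/-- The total variation distance of two laws on a finite type. -/
def tvDist {α : Type*} [Fintype α] [MeasurableSpace α] (μ ν : Measure α) : ℝ :=
  (1 / 2) * ∑ x, |μ.real {x} - ν.real {x}|

end MATU

end

/-!
The comparison of the sampler with the exact reverse process is the entropy (Girsanov) estimate,
used in its dual form, so that no measure on path space is needed. For a positive test function `f`
of the final state, let `U t x` be the mean of `f` when the sampler stands in `x` at time `t`. Up
to an exponential factor this is `unifValue`: the order statistics of the uniform points turn the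
Poisson mixture into the Dyson series of the jump process with the truncated rates. So `U` solves
the backward equation of that process. Along the reverse process with marginals `q_{T-t}`, the
derivative of `E log U` is a sum of terms `u θ - r (e ^ θ - 1)`, where `u` is the true and `r` the
truncated estimated rate of a jump and `θ` the increment of `log U`. By convex duality each such
term is at most the Bregman divergence of `u` from `r`. Truncation does not increase the sum of
these divergences, since the true total rate `numMask / (e ^ (T - t) - 1)` out of a state is at
most `β`: `ofReal_trunc_le_sum_bregman`, `ofReal_drift_le`. Integrating over time and chaining the
segments yields `sampler_log_inequality`: up to the score entropy, the mean of `log f` under the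
reverse process is at most the logarithm of the mean of `f` under the sampler; the start in the
all-mask state costs the mass `1 - (1 - e⁻ᵀ) ^ d ≤ ε² / 4` of the other states.

*Total variation.* Exponential test functions and Hoeffding's lemma give a Pinsker inequality
between `q_δ` and the output (`sum_fwdMarginal_mul_le`), with error at most `ε`. Stopping at time
`δ` costs at most `d δ ≤ ε` (`sum_target_mul_le`).

*Number of evaluations.* The mean number of points in a segment is `K d η m / (e ^ (T - t) - 1)`,
where `t` is the end of the segment and `m` the mean fraction of masked coordinates at its
beginning (`lintegral_samplerLaw_snd`). The same entropy inequality compares `m` with its value `1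
- e ^ (-(T - t) - η)` for the reverse process, and the sum over the segments is compared with an
integral by the midpoint rule. For `d ≥ 2` there is much room (`sum_le_of_two_le_dim`). For `d = 1`
the term `12 K d log d` vanishes and the claim is nearly sharp; there the bound `m ≤ 1` and the
comparison with the reverse process are interpolated, which leaves an inequality in the single
variable `ε` (`sum_le_of_dim_one`).
-/

noncomputable section

namespace MATU

/-! ### The forward process -/

section MatrixExp

variable {n : Type*} [Fintype n] [DecidableEq n]

attribute [local instance] Matrix.linftyOpNormedAddCommGroup Matrix.linftyOpNormedRing
  Matrix.linftyOpNormedAlgebra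

theorem hasDerivAt_matrix_exp_apply (A : Matrix n n ℝ) (i j : n) (t : ℝ) :
    HasDerivAt (fun s : ℝ => NormedSpace.exp (s • A) i j)
      ((NormedSpace.exp (t • A) * A) i j) t := by
  have h := hasDerivAt_exp_smul_const (𝕂 := ℝ) A t
  let L : Matrix n n ℝ →ₗ[ℝ] ℝ :=
    { toFun := fun M => M i j, map_add' := fun _ _ => rfl, map_smul' := fun _ _ => rfl }
  exact (LinearMap.toContinuousLinearMap L).hasFDerivAt.comp_hasDerivAt t h

end MatrixExp

/-- A function of the time with `K' = A K` and `K 0 = 1` is the matrix exponential. -/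
theorem matrix_exp_eq_of_hasDerivAt {n : Type*} [Fintype n] [DecidableEq n] (A : Matrix n n ℝ)
    (k : ℝ → Matrix n n ℝ) (h0 : k 0 = 1)
    (hk : ∀ s i j, HasDerivAt (fun r => k r i j) ((A * k s) i j) s) (s : ℝ) :
    NormedSpace.exp (s • A) = k s := by
  have hneg : ∀ s i j, HasDerivAt (fun r : ℝ => NormedSpace.exp (r • -A) i j)
      ((NormedSpace.exp (s • -A) * -A) i j) s := fun s i j =>
    hasDerivAt_matrix_exp_apply (-A) i j s
  have hder : ∀ i j s, HasDerivAt (fun r : ℝ => (NormedSpace.exp (r • -A) * k r) i j) 0 s := by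
    intro i j s
    simp only [Matrix.mul_apply]
    have h1 := HasDerivAt.fun_sum (u := Finset.univ)
      (fun l _ => (hneg s i l).mul (hk s l j))
    refine h1.congr_deriv ?_
    rw [Finset.sum_add_distrib]
    have e1 : ∑ l, (NormedSpace.exp (s • -A) * -A) i l * k s l j
        = -(NormedSpace.exp (s • -A) * A * k s) i j := by
      simp [Matrix.mul_apply]
    have e2 : ∑ l, NormedSpace.exp (s • -A) i l * (A * k s) l j
        = (NormedSpace.exp (s • -A) * A * k s) i j := by
      rw [Matrix.mul_assoc, Matrix.mul_apply]
    rw [e1, e2]; ring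
  have hconst : NormedSpace.exp (s • -A) * k s = 1 := by
    ext i j
    have := is_const_of_deriv_eq_zero (fun r => (hder i j r).differentiableAt)
      (fun r => (hder i j r).deriv) s 0
    simpa [h0] using this
  have hinv : NormedSpace.exp (s • A) * NormedSpace.exp (s • -A) = 1 := by
    rw [← Matrix.exp_add_of_commute]
    · simp
    · rw [smul_neg]
      exact (Commute.refl _).neg_right
  calc NormedSpace.exp (s • A) = NormedSpace.exp (s • A) * (NormedSpace.exp (s • -A) * k s) := by
        rw [hconst, mul_one]
    _ = k s := by rw [← mul_assoc, hinv, one_mul]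

variable {K d : ℕ} [NeZero K]

/-- The transition probabilities of the forward process at a single coordinate: from the token `c`
to the token `a` in time `s`. -/
def siteKer (s : ℝ) (a c : Fin K) : ℝ :=
  if c = mask K then (if a = mask K then 1 else 0)
  else if a = c then Real.exp (-s) else if a = mask K then 1 - Real.exp (-s) else 0

/-- The transition probabilities of the forward process, from `y` to `x` in time `s`: the
coordinates evolve independently. -/
def fwdKer (s : ℝ) (x y : Seq K d) : ℝ := ∏ i, siteKer s (x i) (y i)

theorem siteKer_nonneg {s : ℝ} (hs : 0 ≤ s) (a c : Fin K) : 0 ≤ siteKer s a c := by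
  have : Real.exp (-s) ≤ 1 := by simpa using hs
  unfold siteKer
  split_ifs <;> positivity

theorem fwdKer_nonneg {s : ℝ} (hs : 0 ≤ s) (x y : Seq K d) : 0 ≤ fwdKer s x y :=
  Finset.prod_nonneg fun _ _ => siteKer_nonneg hs _ _

theorem sum_siteKer (s : ℝ) (c : Fin K) : ∑ a, siteKer s a c = 1 := by
  unfold siteKer
  by_cases h : c = mask K
  · simp [h]
  · have : ∀ a : Fin K, (if a = c then Real.exp (-s) else if a = mask K then 1 - Real.exp (-s)
        else 0) = (if a = c then Real.exp (-s) else 0) +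
          (if a = mask K then 1 - Real.exp (-s) else 0) := by
      intro a
      by_cases h1 : a = c
      · subst h1; simp [h]
      · simp [h1]
    simp [h, this, Finset.sum_add_distrib]

theorem sum_siteKer_ne_mask (s : ℝ) {c : Fin K} (hc : c ≠ mask K) :
    ∑ a ∈ Finset.univ.filter (fun a => a ≠ mask K), siteKer s a c = Real.exp (-s) := by
  have h := sum_siteKer s c
  rw [← Finset.sum_filter_add_sum_filter_not Finset.univ (fun a => a = mask K)] at h
  have h2 : ∑ a ∈ Finset.univ.filter (fun a => a = mask K), siteKer s a c
      = 1 - Real.exp (-s) := by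
    simp [Finset.filter_eq', siteKer, hc, Ne.symm hc]
  linarith

theorem sum_fwdKer (s : ℝ) (y : Seq K d) : ∑ x, fwdKer s x y = 1 := by
  unfold fwdKer
  rw [← Fintype.prod_sum fun i a => siteKer s a (y i)]
  simp [sum_siteKer]

theorem fwdKer_update (s : ℝ) (x y : Seq K d) (i : Fin d) (b : Fin K) :
    fwdKer s (Function.update x i b) y =
      siteKer s b (y i) * ∏ j ∈ Finset.univ.erase i, siteKer s (x j) (y j) := by
  unfold fwdKer
  rw [← Finset.mul_prod_erase _ _ (Finset.mem_univ i)]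
  congr 1
  · simp
  · refine Finset.prod_congr rfl fun j hj => ?_
    rw [Function.update_of_ne (Finset.ne_of_mem_erase hj)]

theorem fwdKer_zero (x y : Seq K d) : fwdKer 0 x y = if x = y then 1 else 0 := by
  have h : ∀ a c : Fin K, siteKer 0 a c = if a = c then 1 else 0 := by
    intro a c
    unfold siteKer
    by_cases h : c = mask K <;> by_cases h' : a = c <;> simp_all
  unfold fwdKer
  simp only [h]
  by_cases hxy : x = y
  · simp [hxy]
  · obtain ⟨i, hi⟩ := Function.ne_iff.mp hxy
    rw [if_neg hxy]
    exact Finset.prod_eq_zero (Finset.mem_univ i) (by simp [hi])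

theorem numMask_le_of_fwdKer_ne_zero {s : ℝ} {x y : Seq K d} (h : fwdKer s x y ≠ 0) :
    numMask y ≤ numMask x := by
  refine Finset.card_le_card fun i hi => ?_
  simp only [Finset.mem_filter, Finset.mem_univ, true_and] at hi ⊢
  by_contra hx
  exact h (Finset.prod_eq_zero (Finset.mem_univ i) (by simp [siteKer, hi, hx]))

/-- The off-diagonal part of the generator acts on functions by unmasking one coordinate. -/
theorem sum_fwdRate_mul (x : Seq K d) (f : Seq K d → ℝ) :
    ∑ z ∈ Finset.univ.filter (fun z => z ≠ x), (fwdRate x z : ℝ) * f z =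
      ∑ i ∈ Finset.univ.filter (fun i => x i = mask K),
        ∑ b ∈ Finset.univ.filter (fun b => b ≠ mask K), f (Function.update x i b) := by
  rw [Finset.sum_sigma']
  symm
  have hrate : ∀ (i : Fin d) (b : Fin K), x i = mask K → b ≠ mask K →
      fwdRate x (Function.update x i b) = 1 := by
    intro i b hi hb
    unfold fwdRate
    rw [if_pos]
    refine ⟨?_, ?_⟩
    · unfold hammingDist
      rw [Finset.card_eq_one]
      refine ⟨i, ?_⟩
      ext j
      by_cases hj : j = i
      · subst hj; simp [hi, Ne.symm hb]
      · simp [hj]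
    · intro j hj
      by_cases hji : j = i
      · rw [hji, hi]
      · simp [hji] at hj
  refine Finset.sum_of_injOn (fun p => Function.update x p.1 p.2) ?_ ?_ ?_ ?_
  · rintro ⟨i, b⟩ hp ⟨j, c⟩ hq h
    simp only [Finset.coe_sigma, Finset.coe_filter, Finset.mem_univ, true_and, Set.mem_sigma_iff,
      Set.mem_ofPred_eq] at hp hq h
    have hij : i = j := by
      by_contra hne
      have := congrFun h i
      rw [Function.update_self, Function.update_of_ne hne, hp.1] at this
      exact hp.2 this
    subst hij
    have := congrFun h i
    simp only [Function.update_self] at this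
    rw [this]
  · rintro ⟨i, b⟩ hp
    simp only [Finset.coe_sigma, Finset.coe_filter, Finset.mem_univ, true_and, Set.mem_sigma_iff,
      Set.mem_ofPred_eq] at hp ⊢
    intro h
    have := congrFun h i
    rw [Function.update_self, hp.1] at this
    exact hp.2 this
  · intro z hz hz'
    have h0 : fwdRate x z = 0 := by
      unfold fwdRate
      rw [if_neg]
      rintro ⟨h1, h2⟩
      unfold hammingDist at h1
      obtain ⟨i, hi⟩ := Finset.card_eq_one.mp h1
      have hi' : ∀ j, x j ≠ z j ↔ j = i := fun j => by
        have := Finset.ext_iff.mp hi j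
        simpa using this
      have hxi : x i = mask K := h2 i ((hi' i).2 rfl)
      apply hz'
      refine ⟨⟨i, z i⟩, ?_, ?_⟩
      · simp only [Finset.coe_sigma, Finset.coe_filter, Finset.mem_univ, true_and,
          Set.mem_sigma_iff, Set.mem_ofPred_eq]
        refine ⟨hxi, fun h => (hi' i).2 rfl ?_⟩
        rw [hxi, h]
      · funext j
        by_cases hj : j = i
        · subst hj; simp
        · simp only [Function.update_of_ne hj]
          by_contra hne
          exact hj ((hi' j).1 hne)
    simp [h0]
  · rintro ⟨i, b⟩ hp
    simp only [Finset.mem_sigma, Finset.mem_filter, Finset.mem_univ, true_and] at hp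
    simp [hrate i b hp.1 hp.2]

theorem sum_fwdGen_mul (x : Seq K d) (f : Seq K d → ℝ) :
    ∑ z, fwdGen K d x z * f z = ∑ i, (if x i = mask K then
      ∑ b ∈ Finset.univ.filter (fun b => b ≠ mask K), f (Function.update x i b) else -f x) := by
  rw [← Finset.sum_filter_add_sum_filter_not Finset.univ (fun z => z ≠ x)]
  have h1 : ∑ z ∈ Finset.univ.filter (fun z => z ≠ x), fwdGen K d x z * f z =
      ∑ z ∈ Finset.univ.filter (fun z => z ≠ x), (fwdRate x z : ℝ) * f z := by
    refine Finset.sum_congr rfl fun z hz => ?_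
    have : x ≠ z := Ne.symm (by simpa using hz)
    simp [fwdGen, this]
  have h2 : ∑ z ∈ Finset.univ.filter (fun z => ¬ z ≠ x), fwdGen K d x z * f z =
      ∑ i, (if x i = mask K then 0 else -f x) := by
    simp only [ne_eq, not_not, Finset.filter_eq', Finset.mem_univ, if_true, Finset.sum_singleton]
    simp only [fwdGen, if_true]
    rw [neg_mul, Finset.sum_mul, ← Finset.sum_neg_distrib]
    refine Finset.sum_congr rfl fun i _ => ?_
    split_ifs <;> simp
  rw [h1, h2, sum_fwdRate_mul, Finset.sum_filter, ← Finset.sum_add_distrib]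
  refine Finset.sum_congr rfl fun i _ => ?_
  split_ifs <;> simp

theorem hasDerivAt_siteKer (s : ℝ) (a c : Fin K) :
    HasDerivAt (fun r => siteKer r a c)
      (if a = mask K then ∑ b ∈ Finset.univ.filter (fun b => b ≠ mask K), siteKer s b c
        else -siteKer s a c) s := by
  have hexp : HasDerivAt (fun r : ℝ => Real.exp (-r)) (-Real.exp (-s)) s := by
    simpa using (hasDerivAt_neg s).exp
  by_cases hc : c = mask K
  · have h0 : ∑ b ∈ Finset.univ.filter (fun b => b ≠ mask K), siteKer s b c = 0 := by
      refine Finset.sum_eq_zero fun b hb => ?_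
      have hb' : b ≠ mask K := by simpa using hb
      simp [siteKer, hc, hb']
    rw [h0]
    by_cases ha : a = mask K
    · simpa [siteKer, hc, ha] using hasDerivAt_const s (1 : ℝ)
    · simpa [siteKer, hc, ha] using hasDerivAt_const s (0 : ℝ)
  · rw [sum_siteKer_ne_mask s hc]
    by_cases ha : a = mask K
    · have hac : a ≠ c := fun h => hc (h ▸ ha)
      simp only [siteKer, if_neg hc, if_neg hac, if_pos ha]
      simpa using hexp.const_sub 1
    · by_cases hac : a = c
      · simpa [siteKer, hc, hac] using hexp
      · simpa [siteKer, hc, hac, ha] using hasDerivAt_const s (0 : ℝ)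

theorem hasDerivAt_fwdKer (s : ℝ) (x y : Seq K d) :
    HasDerivAt (fun r => fwdKer r x y) (∑ z, fwdGen K d x z * fwdKer s z y) s := by
  have h := HasDerivAt.fun_finsetProd (u := Finset.univ)
    (fun i _ => hasDerivAt_siteKer s (x i) (y i))
  refine h.congr_deriv ?_
  rw [sum_fwdGen_mul]
  refine Finset.sum_congr rfl fun i _ => ?_
  rw [smul_eq_mul]
  split_ifs with hi
  · simp_rw [fwdKer_update, ← Finset.sum_mul]
    ring
  · rw [fwdKer, ← Finset.mul_prod_erase _ _ (Finset.mem_univ i)]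
    ring

theorem exp_fwdGen (s : ℝ) :
    NormedSpace.exp (s • fwdGen K d) = fun x y => fwdKer s x y := by
  refine matrix_exp_eq_of_hasDerivAt (fwdGen K d) (fun r => fun x y => fwdKer r x y) ?_ ?_ s
  · ext x y
    rw [fwdKer_zero, Matrix.one_apply]
  · intro s x y
    exact hasDerivAt_fwdKer s x y

/-- The forward equation in the starting state: the generator may be applied on the right. -/
theorem hasDerivAt_fwdKer_right (s : ℝ) (x y : Seq K d) :
    HasDerivAt (fun r => fwdKer r x y) (∑ z, fwdKer s x z * fwdGen K d z y) s := by
  have h := hasDerivAt_matrix_exp_apply (fwdGen K d) x y s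
  simp only [exp_fwdGen] at h
  exact h

theorem fwdMarginal_eq (q : PMF (Seq K d)) (s : ℝ) (x : Seq K d) :
    fwdMarginal q s x = ∑ y, fwdKer s x y * (q y).toReal := by
  simp [fwdMarginal, exp_fwdGen, Matrix.mulVec, dotProduct]

theorem hasDerivAt_fwdMarginal (q : PMF (Seq K d)) (s : ℝ) (x : Seq K d) :
    HasDerivAt (fun r => fwdMarginal q r x) (∑ z, fwdGen K d x z * fwdMarginal q s z) s := by
  simp only [fwdMarginal_eq]
  have h := HasDerivAt.fun_sum (u := Finset.univ)
    (fun y _ => (hasDerivAt_fwdKer s x y).mul_const (q y).toReal)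
  refine h.congr_deriv ?_
  simp_rw [Finset.sum_mul, Finset.mul_sum]
  rw [Finset.sum_comm]
  simp_rw [mul_assoc]

theorem fwdMarginal_nonneg (q : PMF (Seq K d)) {s : ℝ} (hs : 0 ≤ s) (x : Seq K d) :
    0 ≤ fwdMarginal q s x := by
  rw [fwdMarginal_eq]
  exact Finset.sum_nonneg fun y _ => mul_nonneg (fwdKer_nonneg hs x y) ENNReal.toReal_nonneg

theorem sum_toReal_pmf {α : Type*} [Fintype α] (q : PMF α) : ∑ y, (q y).toReal = 1 := by
  rw [← ENNReal.toReal_sum fun y _ => q.apply_ne_top y, ← tsum_fintype (L := .unconditional α),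
    q.tsum_coe, ENNReal.toReal_one]

theorem sum_fwdKer_mul_marginal_weight (q : PMF (Seq K d)) (s : ℝ) (g : Seq K d → ℝ) :
    ∑ x, fwdMarginal q s x * g x = ∑ y, (q y).toReal * ∑ x, fwdKer s x y * g x := by
  simp_rw [fwdMarginal_eq, Finset.sum_mul, Finset.mul_sum]
  rw [Finset.sum_comm]
  refine Finset.sum_congr rfl fun y _ => Finset.sum_congr rfl fun x _ => by ring

theorem sum_fwdMarginal (q : PMF (Seq K d)) (s : ℝ) : ∑ x, fwdMarginal q s x = 1 := by
  have h := sum_fwdKer_mul_marginal_weight q s (fun _ => 1)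
  simpa [sum_fwdKer, sum_toReal_pmf] using h

theorem ne_mask_of_ne_zero (q : PMF (Seq K d)) (hq : ∀ y, q y ≠ 0 → numMask y = 0)
    {y : Seq K d} (hy : q y ≠ 0) (i : Fin d) : y i ≠ mask K := by
  have h := hq y hy
  unfold numMask at h
  rw [Finset.card_eq_zero, Finset.filter_eq_empty_iff] at h
  exact h (Finset.mem_univ i)

/-- The total rate at which the reverse process unmasks a coordinate: conditionally on the visible
tokens, each mask is removed at rate `1 / (e ^ s - 1)`. -/
theorem sum_fwdRate_mul_fwdMarginal (q : PMF (Seq K d)) (hq : ∀ y, q y ≠ 0 → numMask y = 0)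
    {s : ℝ} (hs : 0 < s) (x : Seq K d) :
    ∑ z ∈ Finset.univ.filter (fun z => z ≠ x), (fwdRate x z : ℝ) * fwdMarginal q s z =
      numMask x / (Real.exp s - 1) * fwdMarginal q s x := by
  rw [sum_fwdRate_mul]
  have hpos : 0 < Real.exp s - 1 := by
    have := Real.add_one_lt_exp hs.ne'
    linarith
  have key : ∀ i ∈ Finset.univ.filter (fun i => x i = mask K),
      ∑ b ∈ Finset.univ.filter (fun b => b ≠ mask K), fwdMarginal q s (Function.update x i b) =
        (Real.exp s - 1)⁻¹ * fwdMarginal q s x := by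
    intro i hi
    have hi' : x i = mask K := by simpa using hi
    simp_rw [fwdMarginal_eq]
    rw [Finset.sum_comm, Finset.mul_sum]
    refine Finset.sum_congr rfl fun y _ => ?_
    by_cases hy : q y = 0
    · simp [hy]
    have hyi := ne_mask_of_ne_zero q hq hy i
    rw [← Finset.sum_mul]
    simp_rw [fwdKer_update, ← Finset.sum_mul]
    rw [sum_siteKer_ne_mask s hyi, fwdKer, ← Finset.mul_prod_erase _ _ (Finset.mem_univ i)]
    have h1 : siteKer s (x i) (y i) = 1 - Real.exp (-s) := by
      simp [siteKer, hyi, hi', Ne.symm hyi]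
    have h2 : Real.exp (-s) = (Real.exp s - 1)⁻¹ * (1 - Real.exp (-s)) := by
      rw [Real.exp_neg]
      field_simp
    rw [h1]
    nth_rw 1 [h2]
    ring
  rw [Finset.sum_congr rfl key, Finset.sum_const, nsmul_eq_mul]
  unfold numMask
  ring

theorem sum_fwdKer_mask (s : ℝ) (y : Seq K d) (i : Fin d) (hy : y i ≠ mask K) :
    ∑ x ∈ Finset.univ.filter (fun x : Seq K d => x i = mask K), fwdKer s x y =
      1 - Real.exp (-s) := by
  have h := Fintype.prod_sum (fun j a => (if j = i ∧ a ≠ mask K then 0 else 1) *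
    siteKer s a (y j))
  have h1 : ∀ j, ∑ a, (if j = i ∧ a ≠ mask K then 0 else 1) * siteKer s a (y j) =
      if j = i then 1 - Real.exp (-s) else 1 := by
    intro j
    by_cases hj : j = i
    · subst hj
      have := sum_siteKer s (y j)
      simp only [true_and, if_true, ite_mul, zero_mul, one_mul]
      rw [Finset.sum_eq_single (mask K)]
      · simp [siteKer, hy, Ne.symm hy]
      · intro b _ hb; simp [hb]
      · simp
    · simp [hj, sum_siteKer]
  simp only [h1] at h
  rw [Finset.prod_ite_eq' Finset.univ i] at h
  simp only [Finset.mem_univ, if_true] at h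
  rw [h, Finset.sum_filter]
  refine Finset.sum_congr rfl fun x _ => ?_
  rw [Finset.prod_mul_distrib]
  split_ifs with hx
  · rw [Finset.prod_eq_one, one_mul]
    · rfl
    · intro j _
      rw [if_neg]
      rintro ⟨rfl, h2⟩
      exact h2 hx
  · rw [Finset.prod_eq_zero (Finset.mem_univ i) (by simp [hx]), zero_mul]

/-- The mean number of masks at time `s` of the forward process. -/
theorem sum_fwdMarginal_mul_numMask (q : PMF (Seq K d)) (hq : ∀ y, q y ≠ 0 → numMask y = 0)
    (s : ℝ) : ∑ x, fwdMarginal q s x * (numMask x : ℝ) = d * (1 - Real.exp (-s)) := by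
  rw [sum_fwdKer_mul_marginal_weight]
  have key : ∀ y, (q y).toReal * ∑ x, fwdKer s x y * (numMask x : ℝ) =
      (q y).toReal * (d * (1 - Real.exp (-s))) := by
    intro y
    by_cases hy : q y = 0
    · simp [hy]
    congr 1
    have : ∀ x : Seq K d, (numMask x : ℝ) = ∑ i, if x i = mask K then (1 : ℝ) else 0 := by
      intro x; simp [numMask]
    simp_rw [this, Finset.mul_sum]
    rw [Finset.sum_comm]
    simp_rw [mul_ite, mul_one, mul_zero]
    simp_rw [← Finset.sum_filter]
    rw [Finset.sum_congr rfl fun i _ => sum_fwdKer_mask s y i (ne_mask_of_ne_zero q hq hy i)]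
    simp [mul_sub]
  rw [Finset.sum_congr rfl fun y _ => key y, ← Finset.sum_mul, sum_toReal_pmf, one_mul]

theorem fwdMarginal_mask (q : PMF (Seq K d)) (hq : ∀ y, q y ≠ 0 → numMask y = 0) (s : ℝ) :
    fwdMarginal q s (fun _ => mask K) = (1 - Real.exp (-s)) ^ d := by
  rw [fwdMarginal_eq]
  have key : ∀ y, fwdKer s (fun _ => mask K) y * (q y).toReal =
      (1 - Real.exp (-s)) ^ d * (q y).toReal := by
    intro y
    by_cases hy : q y = 0
    · simp [hy]
    congr 1
    unfold fwdKer
    rw [Finset.prod_congr rfl (g := fun _ => 1 - Real.exp (-s))]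
    · simp
    · intro i _
      have := ne_mask_of_ne_zero q hq hy i
      simp [siteKer, this, Ne.symm this]
  rw [Finset.sum_congr rfl fun y _ => key y, ← Finset.mul_sum, sum_toReal_pmf, mul_one]

theorem le_fwdMarginal (q : PMF (Seq K d)) (hq : ∀ y, q y ≠ 0 → numMask y = 0) {s : ℝ}
    (hs : 0 ≤ s) (x : Seq K d) :
    Real.exp (-(d * s)) * (q x).toReal ≤ fwdMarginal q s x := by
  rw [fwdMarginal_eq]
  refine le_trans ?_ (Finset.single_le_sum (f := fun y => fwdKer s x y * (q y).toReal)
    (fun y _ => mul_nonneg (fwdKer_nonneg hs x y) ENNReal.toReal_nonneg) (Finset.mem_univ x))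
  by_cases hx : q x = 0
  · simp [hx]
  refine mul_le_mul_of_nonneg_right (le_of_eq ?_) ENNReal.toReal_nonneg
  unfold fwdKer
  rw [Finset.prod_congr rfl (g := fun _ => Real.exp (-s))]
  · simp [← Real.exp_nat_mul]
  · intro i _
    have := ne_mask_of_ne_zero q hq hx i
    simp [siteKer, this]

theorem fwdRate_mul_fwdMarginal_eq_zero (q : PMF (Seq K d))
    (hq : ∀ y, q y ≠ 0 → numMask y = 0) {s : ℝ} (hs : 0 < s) {x z : Seq K d} (hzx : z ≠ x)
    (hx : fwdMarginal q s x = 0) : (fwdRate x z : ℝ) * fwdMarginal q s z = 0 := by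
  have h := sum_fwdRate_mul_fwdMarginal q hq hs x
  rw [hx, mul_zero, Finset.sum_eq_zero_iff_of_nonneg fun z _ =>
    mul_nonneg (NNReal.coe_nonneg _) (fwdMarginal_nonneg q hs.le z)] at h
  exact h z (by simpa using hzx)

/-! ### The Bregman divergence and the truncation of the rates -/

theorem ofReal_sum_le_sum_ofReal {ι : Type*} (s : Finset ι) (f : ι → ℝ) :
    ENNReal.ofReal (∑ i ∈ s, f i) ≤ ∑ i ∈ s, ENNReal.ofReal (f i) := by
  classical
  induction s using Finset.induction_on with
  | empty => simp
  | insert a s ha ih =>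
    rw [Finset.sum_insert ha, Finset.sum_insert ha]
    exact ENNReal.ofReal_add_le.trans (by gcongr)

/-- The Fenchel inequality for the Bregman divergence of `c log c`. -/
theorem ofReal_le_bregman {u : ℝ} (hu : 0 ≤ u) (v : ℝ≥0) (θ : ℝ) :
    ENNReal.ofReal (u * θ - v * (Real.exp θ - 1)) ≤ bregman u v := by
  unfold bregman
  split_ifs with hv h0
  · simp [hv, h0]
  · exact le_top
  have hv' : (0 : ℝ) < v := by positivity
  refine ENNReal.ofReal_le_ofReal ?_
  rcases hu.eq_or_lt with rfl | hu
  · have := Real.exp_pos θ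
    simp only [zero_mul, Real.log_zero]
    nlinarith [mul_pos hv' this]
  · have h1 := Real.add_one_le_exp (θ + Real.log v - Real.log u)
    have h2 : Real.exp (θ + Real.log v - Real.log u) = Real.exp θ * v / u := by
      rw [Real.exp_sub, Real.exp_add, Real.exp_log hv', Real.exp_log hu]
    rw [h2, le_div_iff₀ hu] at h1
    nlinarith

/-- Truncating the estimated rates at a bound of the total true rate does not cost anything in the
Fenchel inequality. -/
theorem ofReal_trunc_le_sum_bregman {ι : Type*} (s : Finset ι) (ρ : ι → ℝ) (r : ι → ℝ≥0)
    (β : ℝ≥0) (hρ : ∀ i ∈ s, 0 ≤ ρ i) (hβ : ∑ i ∈ s, ρ i ≤ β) (θ : ι → ℝ) :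
    ENNReal.ofReal (∑ i ∈ s, (ρ i * θ i - ((if β < ∑ j ∈ s, r j then r i * β / ∑ j ∈ s, r j
      else r i : ℝ≥0) : ℝ) * (Real.exp (θ i) - 1))) ≤ ∑ i ∈ s, bregman (ρ i) (r i) := by
  by_cases h : β < ∑ j ∈ s, r j
  · simp only [if_pos h]
    set R : ℝ≥0 := ∑ j ∈ s, r j with hR
    have hRpos : (0 : ℝ) < R := by exact_mod_cast (pos_of_gt h)
    rcases eq_or_ne β 0 with rfl | hβ0
    · have hz : ∀ i ∈ s, ρ i = 0 := by
        refine (Finset.sum_eq_zero_iff_of_nonneg hρ).1 (le_antisymm (by simpa using hβ) ?_)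
        exact Finset.sum_nonneg hρ
      rw [Finset.sum_eq_zero]
      · simp
      · intro i hi
        simp [hz i hi]
    have hβpos : (0 : ℝ) < β := by positivity
    set c : ℝ := β / R with hc
    have hcpos : 0 < c := by positivity
    -- The optimal exponent against the truncated rate is shifted by the logarithm of the factor.
    refine le_trans ?_ ((ofReal_sum_le_sum_ofReal s _).trans (Finset.sum_le_sum fun i hi =>
      ofReal_le_bregman (hρ i hi) (r i) (θ i + Real.log c)))
    refine ENNReal.ofReal_le_ofReal ?_
    have hdiff : ∑ i ∈ s, (ρ i * (θ i + Real.log c) - r i * (Real.exp (θ i + Real.log c) - 1)) -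
        ∑ i ∈ s, (ρ i * θ i - ((r i * β / R : ℝ≥0) : ℝ) * (Real.exp (θ i) - 1)) =
        Real.log c * ∑ i ∈ s, ρ i + (1 - c) * R := by
      have hRsum : (R : ℝ) = ∑ j ∈ s, (r j : ℝ) := by rw [hR, NNReal.coe_sum]
      have hmul : (1 - c) * (R : ℝ) = ∑ j ∈ s, (1 - c) * (r j : ℝ) := by
        rw [hRsum, Finset.mul_sum]
      rw [hmul, Finset.mul_sum, ← Finset.sum_add_distrib, ← Finset.sum_sub_distrib]
      refine Finset.sum_congr rfl fun i _ => ?_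
      rw [Real.exp_add, Real.exp_log hcpos]
      push_cast
      rw [hc]
      ring
    have hRc : (R : ℝ) = β * c⁻¹ := by
      rw [hc]; field_simp
    have hlog : Real.log c⁻¹ ≤ c⁻¹ - 1 := by
      have := Real.log_le_sub_one_of_pos (inv_pos.2 hcpos)
      linarith
    rw [Real.log_inv] at hlog
    have hc1 : c ≤ 1 := by
      rw [hc, div_le_one hRpos]
      exact_mod_cast h.le
    have hlogc : Real.log c ≤ 0 := Real.log_nonpos hcpos.le hc1
    have h3 : Real.log c * β ≤ Real.log c * ∑ i ∈ s, ρ i := mul_le_mul_of_nonpos_left hβ hlogc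
    have h4 : (1 - c) * R = β * (c⁻¹ - 1) := by
      rw [hRc]
      field_simp
    have h5 : 0 ≤ (β : ℝ) * (c⁻¹ - 1 + Real.log c) := mul_nonneg hβpos.le (by linarith)
    nlinarith
  · simp only [if_neg h]
    exact (ofReal_sum_le_sum_ofReal s _).trans (Finset.sum_le_sum fun i hi =>
      ofReal_le_bregman (hρ i hi) (r i) (θ i))

theorem fwdRate_eq_zero_or_one (x y : Seq K d) : fwdRate x y = 0 ∨ fwdRate x y = 1 := by
  unfold fwdRate
  split_ifs <;> simp

theorem bregman_fwdRate_mul (x y : Seq K d) (u : ℝ) (v : ℝ≥0) :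
    bregman (fwdRate x y * u) (fwdRate x y * v) = (fwdRate x y : ℝ≥0∞) * bregman u v := by
  rcases fwdRate_eq_zero_or_one x y with h | h <;> simp [h, bregman]

/-- The integrand of the score entropy at the reverse time `t`, that is, at the forward time
`T - t`. -/
def lossDensity (q : PMF (Seq K d)) (v : ℝ → Seq K d → Seq K d → ℝ≥0) (T t : ℝ) : ℝ≥0∞ :=
  ∑ x, ENNReal.ofReal (fwdMarginal q (T - t) x) *
    ∑ y ∈ Finset.univ.filter (fun y => y ≠ x),
      (fwdRate x y : ℝ≥0∞) * bregman (trueScore q T t x y) (v t x y)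

/-- The drift of `E log U` along the reverse process, from the state `x`, is at most the Bregman
divergence of the true and the estimated rates. -/
theorem ofReal_drift_le (q : PMF (Seq K d)) (hq : ∀ y, q y ≠ 0 → numMask y = 0)
    (v : ℝ → Seq K d → Seq K d → ℝ≥0) {T t : ℝ} (ht : t < T) (β : ℝ≥0) (x : Seq K d)
    (hβ : numMask x / (Real.exp (T - t) - 1) ≤ (β : ℝ)) (hx : fwdMarginal q (T - t) x ≠ 0)
    (θ : Seq K d → ℝ) :
    ENNReal.ofReal (∑ y ∈ Finset.univ.filter (fun y => y ≠ x),
      (fwdRate x y * trueScore q T t x y * θ y - truncRate v β t y x * (Real.exp (θ y) - 1))) ≤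
    ∑ y ∈ Finset.univ.filter (fun y => y ≠ x),
      (fwdRate x y : ℝ≥0∞) * bregman (trueScore q T t x y) (v t x y) := by
  have hs : 0 < T - t := sub_pos.2 ht
  have hsum : ∑ y ∈ Finset.univ.filter (fun y => y ≠ x),
      (fwdRate x y : ℝ) * trueScore q T t x y = numMask x / (Real.exp (T - t) - 1) := by
    have h := sum_fwdRate_mul_fwdMarginal q hq hs x
    unfold trueScore revMarginal
    simp_rw [← mul_div_assoc]
    rw [← Finset.sum_div, h, mul_div_assoc, div_self hx, mul_one]
  have h := ofReal_trunc_le_sum_bregman (Finset.univ.filter (fun y => y ≠ x))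
    (fun y => fwdRate x y * trueScore q T t x y) (fun y => estRate v t y x) β
    (fun y _ => mul_nonneg (NNReal.coe_nonneg _)
      (div_nonneg (fwdMarginal_nonneg q hs.le y) (fwdMarginal_nonneg q hs.le x)))
    (hsum.trans_le hβ) θ
  refine (le_of_eq ?_).trans (h.trans (le_of_eq ?_))
  · rfl
  · refine Finset.sum_congr rfl fun y _ => ?_
    exact bregman_fwdRate_mul x y _ _

/-! ### Sorted uniform points -/

theorem measurableSet_setOf_forall {ι α : Type*} [Countable ι] [MeasurableSpace α]
    {p : ι → α → Prop} (h : ∀ i, MeasurableSet {x | p i x}) : MeasurableSet {x | ∀ i, p i x} := by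
  have : {x | ∀ i, p i x} = ⋂ i, {x | p i x} := by
    ext x
    simp
  rw [this]
  exact MeasurableSet.iInter h

theorem measurable_comp_sort {n : ℕ} : Measurable fun u : Fin n → ℝ => u ∘ Tuple.sort u := by
  have hset : ∀ σ : Equiv.Perm (Fin n), MeasurableSet {u : Fin n → ℝ | σ = Tuple.sort u} := by
    intro σ
    have : {u : Fin n → ℝ | σ = Tuple.sort u} =
        {u | (∀ i j, i ≤ j → u (σ i) ≤ u (σ j)) ∧
          ∀ i j, i < j → u (σ i) = u (σ j) → σ i < σ j} := by
      ext u
      simp only [Set.mem_ofPred_eq, Tuple.eq_sort_iff]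
      rfl
    rw [this]
    refine MeasurableSet.inter (measurableSet_setOf_forall fun i => measurableSet_setOf_forall
      fun j => ?_) (measurableSet_setOf_forall fun i => measurableSet_setOf_forall fun j => ?_)
    · by_cases h : i ≤ j
      · simpa [h] using measurableSet_le (measurable_pi_apply (σ i)) (measurable_pi_apply (σ j))
      · simp [h]
    · by_cases h : i < j
      · by_cases h' : σ i < σ j
        · simp [h']
        · have : MeasurableSet {u : Fin n → ℝ | u (σ i) = u (σ j)} :=
            measurableSet_eq_fun (measurable_pi_apply (σ i)) (measurable_pi_apply (σ j))
          refine this.compl.congr ?_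
          ext u
          simp [h, h']
      · simp [h]
  intro s hs
  have : (fun u : Fin n → ℝ => u ∘ Tuple.sort u) ⁻¹' s =
      ⋃ σ : Equiv.Perm (Fin n), {u | σ = Tuple.sort u} ∩ (fun u => u ∘ σ) ⁻¹' s := by
    ext u
    simp only [Set.mem_preimage, Set.mem_iUnion, Set.mem_inter_iff, Set.mem_ofPred_eq,
      exists_eq_left]
  rw [this]
  refine MeasurableSet.iUnion fun σ => (hset σ).inter ?_
  exact (measurable_pi_lambda _ fun i => measurable_pi_apply (σ i)) hs

theorem ofFn_insertNth_comp_sort {n : ℕ} (i : Fin (n + 1)) (s : ℝ) (u : Fin n → ℝ)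
    (h : ∀ j, s ≤ u j) :
    List.ofFn ((i.insertNth s u : Fin (n + 1) → ℝ) ∘ Tuple.sort (i.insertNth s u)) =
      s :: List.ofFn (u ∘ Tuple.sort u) := by
  refine List.Perm.eq_of_sortedLE (List.sortedLE_ofFn_iff.2 (Tuple.monotone_sort _)) ?_ ?_
  · rw [List.sortedLE_iff_pairwise, List.pairwise_cons]
    refine ⟨fun a ha => ?_,
      (List.sortedLE_iff_pairwise.1 (List.sortedLE_ofFn_iff.2 (Tuple.monotone_sort u)))⟩
    obtain ⟨j, rfl⟩ := (List.mem_ofFn' _ _).1 ha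
    exact h _
  · refine (Equiv.Perm.ofFn_comp_perm _ _).trans ?_
    refine List.Perm.trans ?_ ((Equiv.Perm.ofFn_comp_perm (Tuple.sort u) u).symm.cons s)
    rw [← List.ofFn_cons]
    have : (i.insertNth s u : Fin (n + 1) → ℝ) =
        (Fin.cons s u : Fin (n + 1) → ℝ) ∘ (Fin.cycleRange i) := by
      funext j
      refine Fin.succAboveCases i ?_ (fun k => ?_) j
      · simp [Fin.cycleRange_self]
      · simp [Fin.cycleRange_succAbove]
    rw [this]
    exact Equiv.Perm.ofFn_comp_perm _ _

/-- Decomposition of an integral over a cube according to which coordinate is the smallest. -/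
theorem lintegral_sorted_succ {n : ℕ} (F : List ℝ → ℝ≥0∞)
    (hF : ∀ m, Measurable fun u : Fin m → ℝ => F (List.ofFn u)) (a b : ℝ) :
    ∫⁻ u in Set.univ.pi fun _ : Fin (n + 1) => Set.Ioc a b, F (List.ofFn (u ∘ Tuple.sort u)) =
      (n + 1 : ℝ≥0∞) * ∫⁻ s in Set.Ioc a b, ∫⁻ u in Set.univ.pi fun _ : Fin n => Set.Ioc s b,
        F (s :: List.ofFn (u ∘ Tuple.sort u)) := by
  set A : Set (Fin (n + 1) → ℝ) := Set.univ.pi fun _ => Set.Ioc a b with hA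
  have hAm : MeasurableSet A := MeasurableSet.univ_pi fun _ => measurableSet_Ioc
  let E : Fin (n + 1) → Set (Fin (n + 1) → ℝ) := fun i => {u | ∀ j, u i < u (i.succAbove j)}
  have hEm : ∀ i, MeasurableSet (E i) := fun i => measurableSet_setOf_forall fun j =>
    measurableSet_lt (measurable_pi_apply _) (measurable_pi_apply _)
  have hG : Measurable fun u : Fin (n + 1) → ℝ => F (List.ofFn (u ∘ Tuple.sort u)) :=
    (hF (n + 1)).comp measurable_comp_sort
  have hdisj : Pairwise (Function.onFun Disjoint fun i => A ∩ E i) := by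
    intro i j hij
    rw [Function.onFun, Set.disjoint_left]
    rintro u ⟨-, hi⟩ ⟨-, hj⟩
    obtain ⟨k, rfl⟩ := Fin.exists_succAbove_eq hij.symm
    obtain ⟨l, hl⟩ := Fin.exists_succAbove_eq hij
    have h1 := hi k
    have h2 := hj l
    rw [hl] at h2
    exact lt_asymm h1 h2
  have htie : ∀ i j : Fin (n + 1), i ≠ j → volume {u : Fin (n + 1) → ℝ | u i = u j} = 0 := by
    intro i j hij
    let L : (Fin (n + 1) → ℝ) →ₗ[ℝ] ℝ :=
      LinearMap.proj (R := ℝ) (φ := fun _ : Fin (n + 1) => ℝ) i - LinearMap.proj j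
    have hset : {u : Fin (n + 1) → ℝ | u i = u j} = (LinearMap.ker L : Set _) := by
      ext u
      simp [L, sub_eq_zero]
    rw [hset]
    refine Measure.addHaar_submodule _ _ fun htop => ?_
    have : (Pi.single i 1 : Fin (n + 1) → ℝ) ∈ LinearMap.ker L := htop ▸ Submodule.mem_top
    simp [L, hij] at this
  have hcover : A =ᵐ[volume] ⋃ i, A ∩ E i := by
    have hnull : ∀ᵐ u : Fin (n + 1) → ℝ, ∀ i j, i ≠ j → u i ≠ u j := by
      rw [ae_all_iff]; intro i
      rw [ae_all_iff]; intro j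
      by_cases hij : i = j
      · simp [hij]
      · have := htie i j hij
        rw [measure_eq_zero_iff_ae_notMem] at this
        filter_upwards [this] with u hu _ using hu
    filter_upwards [hnull] with u hu
    refine propext ⟨fun h => ?_, fun h => ?_⟩
    · obtain ⟨i, hi⟩ := Finite.exists_min u
      refine Set.mem_iUnion.2 ⟨i, h, fun j => lt_of_le_of_ne (hi _) (hu _ _ ?_)⟩
      exact (Fin.succAbove_ne i j).symm
    · obtain ⟨i, hi⟩ := Set.mem_iUnion.1 h
      exact hi.1
  rw [setLIntegral_congr hcover, lintegral_iUnion (fun i => hAm.inter (hEm i)) hdisj, tsum_fintype]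
  have hterm : ∀ i, ∫⁻ u in A ∩ E i, F (List.ofFn (u ∘ Tuple.sort u)) =
      ∫⁻ s in Set.Ioc a b, ∫⁻ u in Set.univ.pi fun _ : Fin n => Set.Ioc s b,
        F (s :: List.ofFn (u ∘ Tuple.sort u)) := by
    intro i
    rw [← lintegral_indicator (hAm.inter (hEm i)),
      MeasurePreserving.lintegral_map_equiv _ _
        (volume_preserving_piFinSuccAbove (fun _ : Fin (n + 1) => ℝ) i).symm,
      Measure.volume_eq_prod, lintegral_prod]
    · rw [← lintegral_indicator measurableSet_Ioc]
      refine lintegral_congr fun s => ?_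
      by_cases hs : s ∈ Set.Ioc a b
      · rw [Set.indicator_of_mem hs, ← lintegral_indicator
          (MeasurableSet.univ_pi fun _ => measurableSet_Ioc)]
        refine lintegral_congr fun u => ?_
        change (A ∩ E i).indicator _ (i.insertNth s u : Fin (n + 1) → ℝ) = _
        have hiff : (i.insertNth s u : Fin (n + 1) → ℝ) ∈ A ∩ E i ↔
            u ∈ Set.univ.pi fun _ : Fin n => Set.Ioc s b := by
          constructor
          · rintro ⟨h1, h2⟩ j -
            have h3 := h2 j
            have h4 := h1 (i.succAbove j) (Set.mem_univ _)
            simp only [Fin.insertNth_apply_same, Fin.insertNth_apply_succAbove] at h3 h4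
            exact ⟨h3, h4.2⟩
          · intro h
            refine ⟨fun j _ => ?_, fun j => ?_⟩
            · refine Fin.succAboveCases i ?_ (fun k => ?_) j
              · simpa using hs
              · have := h k (Set.mem_univ _)
                simpa using ⟨hs.1.trans this.1, this.2⟩
            · simpa using (h j (Set.mem_univ _)).1
        by_cases hu : u ∈ Set.univ.pi fun _ : Fin n => Set.Ioc s b
        · rw [Set.indicator_of_mem (hiff.2 hu), Set.indicator_of_mem hu,
            ofFn_insertNth_comp_sort i s u fun j => (hu j (Set.mem_univ _)).1.le]
        · rw [Set.indicator_of_notMem (fun h => hu (hiff.1 h)), Set.indicator_of_notMem hu]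
      · rw [Set.indicator_of_notMem hs]
        refine (lintegral_congr fun u => ?_).trans lintegral_zero
        change (A ∩ E i).indicator _ (i.insertNth s u : Fin (n + 1) → ℝ) = _
        rw [Set.indicator_of_notMem]
        intro h
        have := h.1 i (Set.mem_univ _)
        simp only [Fin.insertNth_apply_same] at this
        exact hs this
    · exact ((hG.indicator (hAm.inter (hEm i))).comp
        (MeasurableEquiv.measurable _)).aemeasurable
  rw [Finset.sum_congr rfl fun i _ => hterm i]
  simp

/-! ### Uniformization and its backward value function -/

theorem measurable_estRate {v : ℝ → Seq K d → Seq K d → ℝ≥0}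
    (hv : ∀ y' y, Measurable fun t => v t y' y) (y z : Seq K d) :
    Measurable fun t => estRate v t y z :=
  measurable_const.mul (hv z y)

theorem measurable_estOut {v : ℝ → Seq K d → Seq K d → ℝ≥0}
    (hv : ∀ y' y, Measurable fun t => v t y' y) (z : Seq K d) :
    Measurable fun t => estOut v t z :=
  Finset.measurable_sum _ fun y _ => measurable_estRate hv y z

theorem measurable_truncRate {v : ℝ → Seq K d → Seq K d → ℝ≥0}
    (hv : ∀ y' y, Measurable fun t => v t y' y) (β : ℝ≥0) (y z : Seq K d) :
    Measurable fun t => truncRate v β t y z :=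
  Measurable.ite (measurableSet_lt measurable_const (measurable_estOut hv z))
    (((measurable_estRate hv y z).mul_const β).div (measurable_estOut hv z))
    (measurable_estRate hv y z)

theorem measurable_stepProb {v : ℝ → Seq K d → Seq K d → ℝ≥0}
    (hv : ∀ y' y, Measurable fun t => v t y' y) (β : ℝ≥0) (z z' : Seq K d) :
    Measurable fun t => stepProb v β t z z' := by
  unfold stepProb
  split_ifs
  · exact measurable_const.sub (measurable_const.mul
      (Finset.measurable_sum _ fun y _ => measurable_truncRate hv β y z))
  · exact measurable_const.mul (measurable_truncRate hv β z' z)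

/-- The mean of `f` at the end of the iterations at the times of a list, from the state `z`. -/
def runMean (v : ℝ → Seq K d → Seq K d → ℝ≥0) (β : ℝ≥0) (f : Seq K d → ℝ≥0∞) (l : List ℝ)
    (z : Seq K d) : ℝ≥0∞ :=
  ∑ z', run v β l z z' * f z'

theorem runMean_nil (v : ℝ → Seq K d → Seq K d → ℝ≥0) (β : ℝ≥0) (f : Seq K d → ℝ≥0∞)
    (z : Seq K d) : runMean v β f [] z = f z := by
  classical
  simp [runMean, run, PMF.pure_apply]

theorem runMean_cons (v : ℝ → Seq K d → Seq K d → ℝ≥0) (β : ℝ≥0) (f : Seq K d → ℝ≥0∞)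
    (τ : ℝ) (l : List ℝ) (z : Seq K d) :
    runMean v β f (τ :: l) z = ∑ z', (stepProb v β τ z z' : ℝ≥0∞) * runMean v β f l z' := by
  simp only [runMean, run, PMF.bind_apply, tsum_fintype, Finset.sum_mul, Finset.mul_sum]
  rw [Finset.sum_comm]
  refine Finset.sum_congr rfl fun x _ => Finset.sum_congr rfl fun y _ => ?_
  rw [mul_assoc]
  rfl

theorem measurable_runMean_ofFn {v : ℝ → Seq K d → Seq K d → ℝ≥0}
    (hv : ∀ y' y, Measurable fun t => v t y' y) (β : ℝ≥0) (f : Seq K d → ℝ≥0∞) (m : ℕ) :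
    ∀ z, Measurable fun u : Fin m → ℝ => runMean v β f (List.ofFn u) z := by
  induction m with
  | zero =>
    intro z
    simp only [List.ofFn_zero]
    exact measurable_const
  | succ m ih =>
    intro z
    simp only [List.ofFn_succ, runMean_cons]
    refine Finset.measurable_sum _ fun z' _ => Measurable.mul ?_ ?_
    · exact ((measurable_stepProb hv β z z').comp (measurable_pi_apply 0)).coe_nnreal_ennreal
    · exact (ih z').comp (measurable_pi_lambda _ fun i => measurable_pi_apply i.succ)

/-- The integral over `n` ordered times in `(t, b]` of the mean of `f` after `n` iterations at
these times. -/
def unifTerm (v : ℝ → Seq K d → Seq K d → ℝ≥0) (β : ℝ≥0) (b : ℝ) (f : Seq K d → ℝ≥0∞) :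
    ℕ → ℝ → Seq K d → ℝ≥0∞
  | 0, _, y => f y
  | n + 1, t, y => ∫⁻ s in Set.Ioc t b, ∑ z, (stepProb v β s y z : ℝ≥0∞) * unifTerm v β b f n s z

theorem measurable_unifTerm (v : ℝ → Seq K d → Seq K d → ℝ≥0) (β : ℝ≥0) (b : ℝ)
    (f : Seq K d → ℝ≥0∞) (n : ℕ) (y : Seq K d) : Measurable fun t => unifTerm v β b f n t y := by
  cases n with
  | zero => exact measurable_const
  | succ n =>
    refine Antitone.measurable fun s t hst => ?_
    exact lintegral_mono_set (Set.Ioc_subset_Ioc_left hst)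

theorem measurable_step_unifTerm {v : ℝ → Seq K d → Seq K d → ℝ≥0}
    (hv : ∀ y' y, Measurable fun t => v t y' y) (β : ℝ≥0) (b : ℝ) (f : Seq K d → ℝ≥0∞) (n : ℕ)
    (y : Seq K d) :
    Measurable fun s => ∑ z, (stepProb v β s y z : ℝ≥0∞) * unifTerm v β b f n s z :=
  Finset.measurable_sum _ fun z _ => (measurable_stepProb hv β y z).coe_nnreal_ennreal.mul
    (measurable_unifTerm v β b f n z)

/-- Sorted independent uniform times are, up to the factor `n!`, ordered times. -/
theorem lintegral_runMean_sorted {v : ℝ → Seq K d → Seq K d → ℝ≥0}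
    (hv : ∀ y' y, Measurable fun t => v t y' y) (β : ℝ≥0) (b : ℝ) (f : Seq K d → ℝ≥0∞) (n : ℕ) :
    ∀ a z, ∫⁻ u in Set.univ.pi fun _ : Fin n => Set.Ioc a b,
      runMean v β f (List.ofFn (u ∘ Tuple.sort u)) z = n.factorial * unifTerm v β b f n a z := by
  induction n with
  | zero =>
    intro a z
    simp only [List.ofFn_zero, runMean_nil, unifTerm, lintegral_const,
      Measure.restrict_apply_univ, volume_pi_pi]
    simp
  | succ n ih =>
    intro a z
    rw [lintegral_sorted_succ (fun l => runMean v β f l z)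
      (fun m => measurable_runMean_ofFn hv β f m z)]
    have h : ∀ s, ∫⁻ u in Set.univ.pi fun _ : Fin n => Set.Ioc s b,
        runMean v β f (s :: List.ofFn (u ∘ Tuple.sort u)) z =
        n.factorial * ∑ z', (stepProb v β s z z' : ℝ≥0∞) * unifTerm v β b f n s z' := by
      intro s
      simp only [runMean_cons]
      rw [lintegral_finsetSum]
      · rw [Finset.mul_sum]
        refine Finset.sum_congr rfl fun z' _ => ?_
        rw [lintegral_const_mul, ih s z']
        · ring
        · exact (measurable_runMean_ofFn hv β f n z').comp measurable_comp_sort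
      · intro z' _
        exact ((measurable_runMean_ofFn hv β f n z').comp measurable_comp_sort).const_mul _
    simp only [h]
    rw [lintegral_const_mul _ (measurable_step_unifTerm hv β b f n z), unifTerm, ← mul_assoc]
    congr 1
    rw [Nat.factorial_succ]
    push_cast
    ring

/-- The value function of the uniformization, up to the factor `e ^ (-β (b - t))`. -/
def unifValue (v : ℝ → Seq K d → Seq K d → ℝ≥0) (β : ℝ≥0) (b : ℝ) (f : Seq K d → ℝ≥0∞) (t : ℝ)
    (y : Seq K d) : ℝ≥0∞ :=
  ∑' n, (β : ℝ≥0∞) ^ n * unifTerm v β b f n t y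

theorem measurable_unifValue (v : ℝ → Seq K d → Seq K d → ℝ≥0) (β : ℝ≥0) (b : ℝ)
    (f : Seq K d → ℝ≥0∞) (y : Seq K d) : Measurable fun t => unifValue v β b f t y :=
  Measurable.tsum fun n => (measurable_unifTerm v β b f n y).const_mul _

/-- The backward equation of the uniformization, in integral form. -/
theorem unifValue_eq {v : ℝ → Seq K d → Seq K d → ℝ≥0}
    (hv : ∀ y' y, Measurable fun t => v t y' y) (β : ℝ≥0) (b : ℝ) (f : Seq K d → ℝ≥0∞) (t : ℝ)
    (y : Seq K d) :
    unifValue v β b f t y = f y + ∫⁻ s in Set.Ioc t b,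
      (β : ℝ≥0∞) * ∑ z, (stepProb v β s y z : ℝ≥0∞) * unifValue v β b f s z := by
  have h : ∀ s, (β : ℝ≥0∞) * ∑ z, (stepProb v β s y z : ℝ≥0∞) * unifValue v β b f s z =
      ∑' n, (β : ℝ≥0∞) ^ (n + 1) *
        ∑ z, (stepProb v β s y z : ℝ≥0∞) * unifTerm v β b f n s z := by
    intro s
    simp only [unifValue, ← ENNReal.tsum_mul_left, Finset.mul_sum]
    rw [Summable.tsum_finsetSum (fun _ _ => ENNReal.summable)]
    refine Finset.sum_congr rfl fun z _ => tsum_congr fun n => ?_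
    rw [pow_succ]
    ring
  simp only [h]
  rw [lintegral_tsum fun n => ((measurable_step_unifTerm hv β b f n y).const_mul _).aemeasurable]
  rw [unifValue, tsum_eq_zero_add' ENNReal.summable]
  simp only [pow_zero, one_mul, unifTerm]
  congr 1
  refine tsum_congr fun n => ?_
  rw [lintegral_const_mul _ (measurable_step_unifTerm hv β b f n y)]

theorem unifTerm_mono (v : ℝ → Seq K d → Seq K d → ℝ≥0) (β : ℝ≥0) (b : ℝ)
    {f g : Seq K d → ℝ≥0∞} (hfg : ∀ y, f y ≤ g y) (n : ℕ) :
    ∀ t y, unifTerm v β b f n t y ≤ unifTerm v β b g n t y := by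
  induction n with
  | zero => exact fun _ y => hfg y
  | succ n ih =>
    intro t y
    exact lintegral_mono fun s => Finset.sum_le_sum fun z _ => by gcongr; exact ih s z

theorem lintegral_pow_div_factorial {t b : ℝ} (h : t ≤ b) (n : ℕ) :
    ∫⁻ s in Set.Ioc t b, ENNReal.ofReal ((b - s) ^ n / n.factorial) =
      ENNReal.ofReal ((b - t) ^ (n + 1) / (n + 1).factorial) := by
  rw [← ofReal_integral_eq_lintegral_ofReal]
  · rw [← intervalIntegral.integral_of_le h, intervalIntegral.integral_div,
      intervalIntegral.integral_comp_sub_left (fun x => x ^ n), sub_self, integral_pow,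
      Nat.factorial_succ]
    congr 1
    push_cast
    field_simp
    simp
  · exact (Continuous.integrableOn_Icc (by fun_prop)).mono_set Set.Ioc_subset_Icc_self
  · filter_upwards [ae_restrict_mem measurableSet_Ioc] with s hs
    have : 0 ≤ b - s := sub_nonneg.2 hs.2
    simp only [Pi.zero_apply]
    positivity

theorem unifTerm_const (v : ℝ → Seq K d → Seq K d → ℝ≥0) (β : ℝ≥0) (b : ℝ) (c : ℝ≥0∞) (n : ℕ) :
    ∀ t, t ≤ b → ∀ y, unifTerm v β b (fun _ => c) n t y =
      c * ENNReal.ofReal ((b - t) ^ n / n.factorial) := by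
  induction n with
  | zero => intro t _ y; simp [unifTerm]
  | succ n ih =>
    intro t ht y
    rw [← lintegral_pow_div_factorial ht, ← lintegral_const_mul _ (by fun_prop), unifTerm]
    refine setLIntegral_congr_fun measurableSet_Ioc fun s hs => ?_
    simp only [ih s hs.2]
    rw [← Finset.sum_mul, sum_stepProb, one_mul]

theorem unifValue_const (v : ℝ → Seq K d → Seq K d → ℝ≥0) (β : ℝ≥0) {t b : ℝ} (h : t ≤ b)
    (c : ℝ≥0∞) (y : Seq K d) :
    unifValue v β b (fun _ => c) t y = c * ENNReal.ofReal (Real.exp (β * (b - t))) := by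
  have h0 : 0 ≤ b - t := sub_nonneg.2 h
  rw [Real.exp_eq_exp_ℝ, NormedSpace.exp_eq_tsum_div]
  dsimp only
  rw [ENNReal.ofReal_tsum_of_nonneg (fun n => by positivity)
    (NormedSpace.expSeries_div_summable (𝔸 := ℝ) _),
    ← ENNReal.tsum_mul_left, unifValue]
  refine tsum_congr fun n => ?_
  rw [unifTerm_const v β b c n t h y, mul_pow, mul_div_assoc, ENNReal.ofReal_mul (by positivity),
    ENNReal.ofReal_pow (by positivity), ENNReal.ofReal_coe_nnreal]
  ring

theorem unifValue_mono (v : ℝ → Seq K d → Seq K d → ℝ≥0) (β : ℝ≥0) (b : ℝ)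
    {f g : Seq K d → ℝ≥0∞} (hfg : ∀ y, f y ≤ g y) (t : ℝ) (y : Seq K d) :
    unifValue v β b f t y ≤ unifValue v β b g t y :=
  ENNReal.tsum_le_tsum fun n => by gcongr; exact unifTerm_mono v β b hfg n t y

/-! ### The law of the sampler -/

theorem pi_cond_Icc {a b : ℝ} (h : a < b) (n : ℕ) :
    Measure.pi (fun _ : Fin n => (volume : Measure ℝ)[|Set.Icc a b]) =
      (ENNReal.ofReal (b - a))⁻¹ ^ n •
        (volume : Measure (Fin n → ℝ)).restrict (Set.univ.pi fun _ => Set.Ioc a b) := by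
  have hvol : (volume : Measure ℝ) (Set.Icc a b) = ENNReal.ofReal (b - a) := Real.volume_Icc
  have : IsProbabilityMeasure ((volume : Measure ℝ)[|Set.Icc a b]) := by
    refine cond_isProbabilityMeasure_of_finite ?_ ?_
    · rw [hvol]
      simpa using h
    · rw [hvol]
      exact ENNReal.ofReal_ne_top
  refine Measure.pi_eq fun s hs => ?_
  rw [Measure.smul_apply, volume_pi, Measure.restrict_pi_pi, Measure.pi_pi, smul_eq_mul]
  simp only [ProbabilityTheory.cond, hvol, Measure.smul_apply, smul_eq_mul,
    Finset.prod_mul_distrib, Finset.prod_const, Finset.card_univ, Fintype.card_fin]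
  rw [Measure.restrict_congr_set Ioc_ae_eq_Icc]

theorem isProbabilityMeasure_cond_Icc {a b : ℝ} (h : a < b) :
    IsProbabilityMeasure ((volume : Measure ℝ)[|Set.Icc a b]) := by
  refine cond_isProbabilityMeasure_of_finite ?_ ?_
  · simpa using h
  · simp

theorem lintegral_toMeasure_map {K d : ℕ} (P : PMF (Seq K d)) (k : ℕ) (g : Seq K d × ℕ → ℝ≥0∞) :
    ∫⁻ x, g x ∂(P.map fun z => (z, k)).toMeasure = ∑ z, P z * g (z, k) := by
  rw [← PMF.toMeasure_map _ _ (Measurable.of_discrete), lintegral_map Measurable.of_discrete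
    Measurable.of_discrete, lintegral_fintype]
  refine Finset.sum_congr rfl fun z _ => ?_
  rw [PMF.toMeasure_apply_singleton _ _ (measurableSet_singleton z), mul_comm]

theorem measurable_toMeasure_run {v : ℝ → Seq K d → Seq K d → ℝ≥0}
    (hv : ∀ y' y, Measurable fun t => v t y' y) (β : ℝ≥0) (n k : ℕ) (z : Seq K d) :
    Measurable fun u : Fin n → ℝ =>
      ((run v β (List.ofFn (u ∘ Tuple.sort u)) z).map fun z' => (z', k)).toMeasure := by
  refine Measure.measurable_of_measurable_coe _ fun s hs => ?_
  have h : ∀ u : Fin n → ℝ,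
      ((run v β (List.ofFn (u ∘ Tuple.sort u)) z).map fun z' => (z', k)).toMeasure s =
      runMean v β (fun z' => s.indicator 1 (z', k)) (List.ofFn (u ∘ Tuple.sort u)) z := by
    intro u
    rw [← lintegral_indicator_one hs, lintegral_toMeasure_map]
    rfl
  simp only [h]
  exact (measurable_runMean_ofFn hv β _ n z).comp measurable_comp_sort

theorem lintegral_segment {v : ℝ → Seq K d → Seq K d → ℝ≥0}
    (hv : ∀ y' y, Measurable fun t => v t y' y) (T a b : ℝ) (x : Seq K d × ℕ)
    (g : Seq K d × ℕ → ℝ≥0∞) :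
    ∫⁻ w, g w ∂(segment v T a b x) =
      ∫⁻ n, ∫⁻ u, runMean v (beta T b x.1) (fun z => g (z, x.2 + n))
        (List.ofFn (u ∘ Tuple.sort u)) x.1
        ∂(Measure.pi fun _ : Fin n => (volume : Measure ℝ)[|Set.Icc a b])
        ∂(poissonMeasure (beta T b x.1 * Real.toNNReal (b - a))) := by
  unfold segment
  rw [Measure.lintegral_bind Measurable.of_discrete.aemeasurable
    Measurable.of_discrete.aemeasurable]
  refine lintegral_congr fun n => ?_
  rw [Measure.lintegral_bind (measurable_toMeasure_run hv _ n _ _).aemeasurable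
    Measurable.of_discrete.aemeasurable]
  refine lintegral_congr fun u => ?_
  rw [lintegral_toMeasure_map]
  rfl

theorem isProbabilityMeasure_segment {v : ℝ → Seq K d → Seq K d → ℝ≥0}
    (hv : ∀ y' y, Measurable fun t => v t y' y) (T : ℝ) {a b : ℝ} (h : a < b)
    (x : Seq K d × ℕ) : IsProbabilityMeasure (segment v T a b x) := by
  have := isProbabilityMeasure_cond_Icc h
  refine isProbabilityMeasure_bind Measurable.of_discrete.aemeasurable
    (Filter.Eventually.of_forall fun n => ?_)
  refine isProbabilityMeasure_bind (measurable_toMeasure_run hv _ n _ _).aemeasurable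
    (Filter.Eventually.of_forall fun u => ?_)
  infer_instance

theorem lintegral_poissonMeasure_eq (r : ℝ≥0) (g : ℕ → ℝ≥0∞) :
    ∫⁻ n, g n ∂(poissonMeasure r) =
      ∑' n, ENNReal.ofReal (Real.exp (-r) * r ^ n / n.factorial) * g n := by
  rw [poissonMeasure, lintegral_sum_measure]
  refine tsum_congr fun n => ?_
  rw [lintegral_smul_measure, lintegral_dirac, smul_eq_mul]

theorem lintegral_poissonMeasure_coe (r : ℝ≥0) : ∫⁻ n, (n : ℝ≥0∞) ∂(poissonMeasure r) = r := by
  rw [lintegral_poissonMeasure_eq, tsum_eq_zero_add' ENNReal.summable]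
  have h : ∀ n : ℕ, ENNReal.ofReal (Real.exp (-r) * r ^ (n + 1) / (n + 1).factorial) *
      ((n + 1 : ℕ) : ℝ≥0∞) =
      r * (ENNReal.ofReal (Real.exp (-r) * r ^ n / n.factorial) * 1) := by
    intro n
    rw [mul_one, ← ENNReal.ofReal_natCast, ← ENNReal.ofReal_mul (by positivity),
      ← ENNReal.ofReal_coe_nnreal, ← ENNReal.ofReal_mul (by positivity), Nat.factorial_succ]
    congr 1
    push_cast
    field_simp
    ring
  simp only [h, ENNReal.tsum_mul_left]
  rw [← ENNReal.tsum_mul_left, ENNReal.tsum_mul_left, ← lintegral_poissonMeasure_eq]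
  simp

/-- The mean of a function of the state after one segment, in terms of the value function. -/
theorem lintegral_segment_fst {v : ℝ → Seq K d → Seq K d → ℝ≥0}
    (hv : ∀ y' y, Measurable fun t => v t y' y) (T : ℝ) {a b : ℝ} (h : a < b)
    (x : Seq K d × ℕ) (f : Seq K d → ℝ≥0∞) :
    ∫⁻ w, f w.1 ∂(segment v T a b x) =
      ENNReal.ofReal (Real.exp (-(beta T b x.1 * (b - a)))) *
        unifValue v (beta T b x.1) b f a x.1 := by
  have hba : 0 < b - a := sub_pos.2 h
  rw [lintegral_segment hv, lintegral_poissonMeasure_eq, unifValue, ← ENNReal.tsum_mul_left]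
  generalize beta T b x.1 = β
  refine tsum_congr fun n => ?_
  rw [pi_cond_Icc h, lintegral_smul_measure, lintegral_runMean_sorted hv, smul_eq_mul,
    ← ENNReal.ofReal_inv_of_pos hba, ← ENNReal.ofReal_pow (by positivity), ← mul_assoc,
    ← mul_assoc, ← mul_assoc, ← ENNReal.ofReal_coe_nnreal (p := β),
    ← ENNReal.ofReal_pow (by positivity), ← ENNReal.ofReal_natCast,
    ← ENNReal.ofReal_mul (by positivity), ← ENNReal.ofReal_mul (by positivity),
    ← ENNReal.ofReal_mul (by positivity)]
  congr 2
  rw [NNReal.coe_mul, Real.coe_toNNReal _ hba.le, mul_pow, inv_pow]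
  field_simp

theorem lintegral_segment_snd {v : ℝ → Seq K d → Seq K d → ℝ≥0}
    (hv : ∀ y' y, Measurable fun t => v t y' y) (T : ℝ) {a b : ℝ} (h : a < b)
    (x : Seq K d × ℕ) :
    ∫⁻ w, (w.2 : ℝ≥0∞) ∂(segment v T a b x) =
      x.2 + (beta T b x.1 : ℝ≥0∞) * ENNReal.ofReal (b - a) := by
  have := isProbabilityMeasure_cond_Icc h
  rw [lintegral_segment hv]
  have h1 : ∀ n : ℕ, ∀ l, runMean v (beta T b x.1)
      (fun z => (((z, x.2 + n) : Seq K d × ℕ).2 : ℝ≥0∞)) l x.1 = x.2 + n := by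
    intro n l
    simp only [runMean]
    rw [← Finset.sum_mul, ← tsum_fintype (L := .unconditional _), PMF.tsum_coe, one_mul]
    push_cast
    rfl
  simp only [h1, lintegral_const, measure_univ, mul_one]
  rw [lintegral_add_left measurable_const, lintegral_const, measure_univ, mul_one,
    lintegral_poissonMeasure_coe]
  push_cast
  rfl

theorem isProbabilityMeasure_samplerLaw {v : ℝ → Seq K d → Seq K d → ℝ≥0}
    (hv : ∀ y' y, Measurable fun t => v t y' y) (T : ℝ) (p : ℕ → ℝ) (w : ℕ)
    (hp : ∀ i < w, p i < p (i + 1)) : IsProbabilityMeasure (samplerLaw v T p w) := by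
  induction w with
  | zero =>
    unfold samplerLaw
    infer_instance
  | succ w ih =>
    have := ih fun i hi => hp i (hi.trans w.lt_succ_self)
    exact isProbabilityMeasure_bind Measurable.of_discrete.aemeasurable
      (Filter.Eventually.of_forall fun x =>
        isProbabilityMeasure_segment hv T (hp w w.lt_succ_self) x)

/-! ### The backward equation almost everywhere -/

theorem sum_stepProb_real (v : ℝ → Seq K d → Seq K d → ℝ≥0) (β : ℝ≥0) (τ : ℝ) (z : Seq K d) :
    ∑ z', (stepProb v β τ z z' : ℝ) = 1 := by
  have h := sum_stepProb v β τ z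
  rw [← ENNReal.ofNNReal_finsetSum, ENNReal.coe_eq_one] at h
  rw [← NNReal.coe_sum, h, NNReal.coe_one]

/-- The value function of the uniformization is Lipschitz, bounded below, and satisfies the
backward equation almost everywhere. -/
theorem exists_backward_solution {v : ℝ → Seq K d → Seq K d → ℝ≥0}
    (hv : ∀ y' y, Measurable fun t => v t y' y) (β : ℝ≥0) {a b : ℝ} (hab : a < b)
    {f : Seq K d → ℝ} {m M : ℝ} (hm : 0 < m) (hmf : ∀ y, m ≤ f y) (hfM : ∀ y, f y ≤ M) :
    ∃ W : ℝ → Seq K d → ℝ,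
      (∀ t ∈ Set.Icc a b, ∀ y, m ≤ W t y) ∧
      (∀ y, ∃ C : ℝ≥0, LipschitzOnWith C (fun t => W t y) (Set.Icc a b)) ∧
      (∀ᵐ t, t ∈ Set.Ioo a b → ∀ y, HasDerivAt (fun r => W r y)
        (-(β * ∑ z, (stepProb v β t y z : ℝ) * W t z)) t) ∧
      (∀ y, W b y = f y) ∧
      (∀ y, ENNReal.ofReal (W a y) =
        unifValue v β b (fun y => ENNReal.ofReal (f y)) a y) := by
  set F : Seq K d → ℝ≥0∞ := fun y => ENNReal.ofReal (f y) with hF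
  set V : ℝ → Seq K d → ℝ := fun t y => (unifValue v β b F t y).toReal with hV
  have hM : 0 ≤ M := hm.le.trans ((hmf (fun _ => mask K)).trans (hfM _))
  set B : ℝ := M * Real.exp (β * (b - a)) with hB
  have hB0 : 0 ≤ B := by positivity
  have hupper : ∀ t ∈ Set.Icc a b, ∀ y, unifValue v β b F t y ≤ ENNReal.ofReal B := by
    intro t ht y
    refine (unifValue_mono v β b (g := fun _ => ENNReal.ofReal M)
      (fun y => ENNReal.ofReal_le_ofReal (hfM y)) t y).trans ?_
    rw [unifValue_const v β ht.2, ← ENNReal.ofReal_mul hM]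
    refine ENNReal.ofReal_le_ofReal ?_
    rw [hB]
    gcongr
    exact ht.1
  have hfin : ∀ t ∈ Set.Icc a b, ∀ y, unifValue v β b F t y ≠ ∞ := fun t ht y =>
    ne_top_of_le_ne_top ENNReal.ofReal_ne_top (hupper t ht y)
  have hVB : ∀ t ∈ Set.Icc a b, ∀ y, V t y ≤ B := fun t ht y =>
    ENNReal.toReal_le_of_le_ofReal hB0 (hupper t ht y)
  have hVm : ∀ t ∈ Set.Icc a b, ∀ y, m ≤ V t y := by
    intro t ht y
    refine (ENNReal.ofReal_le_iff_le_toReal (hfin t ht y)).1 ?_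
    refine le_trans ?_ (unifValue_mono v β b (f := fun _ => ENNReal.ofReal m)
      (fun y => ENNReal.ofReal_le_ofReal (hmf y)) t y)
    rw [unifValue_const v β ht.2]
    refine le_mul_of_one_le_right' ?_
    rw [← ENNReal.ofReal_one]
    refine ENNReal.ofReal_le_ofReal (Real.one_le_exp ?_)
    have := sub_nonneg.2 ht.2
    positivity
  set φ : Seq K d → ℝ → ℝ := fun y s => β * ∑ z, (stepProb v β s y z : ℝ) * V s z with hφ
  have hVmeas : ∀ y, Measurable fun t => V t y := fun y =>
    (measurable_unifValue v β b F y).ennreal_toReal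
  have hφm : ∀ y, Measurable (φ y) := fun y => (Finset.measurable_sum _ fun z _ =>
    (measurable_stepProb hv β y z).coe_nnreal_real.mul (hVmeas z)).const_mul _
  have hφB : ∀ s ∈ Set.Icc a b, ∀ y, ‖φ y s‖ ≤ β * B := by
    intro s hs y
    have h0 : 0 ≤ ∑ z, (stepProb v β s y z : ℝ) * V s z := Finset.sum_nonneg fun z _ =>
      mul_nonneg (NNReal.coe_nonneg _) ENNReal.toReal_nonneg
    rw [Real.norm_eq_abs, abs_of_nonneg (mul_nonneg β.coe_nonneg h0)]
    refine mul_le_mul_of_nonneg_left ?_ β.coe_nonneg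
    calc ∑ z, (stepProb v β s y z : ℝ) * V s z ≤ ∑ z, (stepProb v β s y z : ℝ) * B :=
          Finset.sum_le_sum fun z _ =>
            mul_le_mul_of_nonneg_left (hVB s hs z) (NNReal.coe_nonneg _)
      _ = B := by rw [← Finset.sum_mul, sum_stepProb_real, one_mul]
  have hint : ∀ y, IntegrableOn (φ y) (Set.Icc a b) := fun y =>
    Measure.integrableOn_of_bounded (by simp) (hφm y).aestronglyMeasurable
      ((ae_restrict_mem measurableSet_Icc).mono fun s hs => hφB s hs y)
  have hii : ∀ y, ∀ s ∈ Set.Icc a b, ∀ t ∈ Set.Icc a b, IntervalIntegrable (φ y) volume s t := by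
    intro y s hs t ht
    rw [intervalIntegrable_iff]
    exact (hint y).mono_set (Set.uIoc_subset_uIcc.trans (Set.uIcc_subset_Icc hs ht))
  have haI : a ∈ Set.Icc a b := Set.left_mem_Icc.2 hab.le
  have hbI : b ∈ Set.Icc a b := Set.right_mem_Icc.2 hab.le
  have heq : ∀ t ∈ Set.Icc a b, ∀ y, V t y = f y + ∫ s in t..b, φ y s := by
    intro t ht y
    have hsub : Set.Ioc t b ⊆ Set.Icc a b := fun s hs => ⟨ht.1.trans hs.1.le, hs.2⟩
    have hfinite : ∀ s ∈ Set.Ioc t b, (β : ℝ≥0∞) *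
        ∑ z, (stepProb v β s y z : ℝ≥0∞) * unifValue v β b F s z < ∞ := by
      intro s hs
      refine ENNReal.mul_lt_top ENNReal.coe_lt_top (ENNReal.sum_lt_top.2 fun z _ => ?_)
      exact ENNReal.mul_lt_top ENNReal.coe_lt_top (hfin s (hsub hs) z).lt_top
    have htoReal : ∀ s ∈ Set.Ioc t b, φ y s = ((β : ℝ≥0∞) *
        ∑ z, (stepProb v β s y z : ℝ≥0∞) * unifValue v β b F s z).toReal := by
      intro s hs
      rw [ENNReal.toReal_mul, ENNReal.toReal_sum fun z _ =>
        (ENNReal.mul_lt_top ENNReal.coe_lt_top (hfin s (hsub hs) z).lt_top).ne]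
      simp [hφ, hV, ENNReal.toReal_mul]
    have hmeas : Measurable fun s => (β : ℝ≥0∞) *
        ∑ z, (stepProb v β s y z : ℝ≥0∞) * unifValue v β b F s z :=
      (Finset.measurable_sum _ fun z _ => (measurable_stepProb hv β y z).coe_nnreal_ennreal.mul
        (measurable_unifValue v β b F z)).const_mul _
    have h1 : ∫ s in t..b, φ y s = (∫⁻ s in Set.Ioc t b, (β : ℝ≥0∞) *
        ∑ z, (stepProb v β s y z : ℝ≥0∞) * unifValue v β b F s z).toReal := by
      rw [intervalIntegral.integral_of_le ht.2, setIntegral_congr_fun measurableSet_Ioc htoReal,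
        integral_toReal hmeas.aemeasurable]
      filter_upwards [ae_restrict_mem measurableSet_Ioc] with s hs using hfinite s hs
    have h2 := unifValue_eq hv β b F t y
    have h3 := hfin t ht y
    rw [h2, ENNReal.add_ne_top] at h3
    rw [h1, hV]
    simp only
    rw [h2, ENNReal.toReal_add h3.1 h3.2, hF, ENNReal.toReal_ofReal (hm.le.trans (hmf y))]
  refine ⟨V, hVm, fun y => ⟨β * Real.toNNReal B, ?_⟩, ?_, fun y => ?_, fun y => ?_⟩
  · refine LipschitzOnWith.of_dist_le_mul fun s hs t ht => ?_
    have hsplit := intervalIntegral.integral_add_adjacent_intervals (hii y s hs t ht)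
      (hii y t ht b hbI)
    rw [heq s hs y, heq t ht y, dist_add_left, Real.dist_eq, ← hsplit, add_sub_cancel_right,
      NNReal.coe_mul, Real.coe_toNNReal _ hB0, Real.dist_eq, abs_sub_comm s t]
    exact intervalIntegral.norm_integral_le_of_norm_le_const fun r hr =>
      hφB r (Set.uIcc_subset_Icc hs ht (Set.uIoc_subset_uIcc hr)) y
  · have hae : ∀ᵐ t, ∀ y, t ∈ Set.uIcc a b → ∀ c ∈ Set.uIcc a b,
        HasDerivAt (fun x => ∫ s in c..x, φ y s) (φ y t) t :=
      ae_all_iff.2 fun y => (hii y a haI b hbI).ae_hasDerivAt_integral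
    filter_upwards [hae] with t ht htI y
    have hder := (ht y (by rw [Set.uIcc_of_le hab.le]; exact Set.Ioo_subset_Icc_self htI) b
      (by rw [Set.uIcc_of_le hab.le]; exact hbI)).neg.const_add (f y)
    refine hder.congr_of_eventuallyEq ?_
    filter_upwards [Ioo_mem_nhds htI.1 htI.2] with r hr
    rw [heq r (Set.Ioo_subset_Icc_self hr) y, intervalIntegral.integral_symm]
    rfl
  · have := heq b hbI y
    simpa using this
  · exact ENNReal.ofReal_toReal (hfin a haI y)

theorem coe_mul_sum_stepProb (v : ℝ → Seq K d → Seq K d → ℝ≥0) (β : ℝ≥0) (τ : ℝ) (x : Seq K d)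
    (g : Seq K d → ℝ) :
    β * ∑ z, (stepProb v β τ x z : ℝ) * g z = β * g x +
      ∑ z ∈ Finset.univ.filter (fun z => z ≠ x), (truncRate v β τ z x : ℝ) * (g z - g x) := by
  have h1 : β * ∑ z, (stepProb v β τ x z : ℝ) * g z = β * g x +
      ∑ z, (β * stepProb v β τ x z : ℝ) * (g z - g x) := by
    simp only [mul_sub, Finset.sum_sub_distrib, ← Finset.sum_mul, ← Finset.mul_sum,
      sum_stepProb_real, mul_assoc]
    ring
  rw [h1]
  congr 1
  rw [← Finset.sum_filter_add_sum_filter_not Finset.univ (fun z => z ≠ x)]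
  have h2 : ∑ z ∈ Finset.univ.filter (fun z => ¬ z ≠ x),
      (β * stepProb v β τ x z : ℝ) * (g z - g x) = 0 := by
    refine Finset.sum_eq_zero fun z hz => ?_
    have : z = x := by simpa using hz
    simp [this]
  rw [h2, add_zero]
  refine Finset.sum_congr rfl fun z hz => ?_
  have hz' : z ≠ x := by simpa using hz
  congr 1
  rw [stepProb, if_neg hz']
  rcases eq_or_ne β 0 with rfl | hβ
  · have : truncRate v 0 τ z x = 0 := by
      unfold truncRate
      split_ifs with h
      · simp
      · have h0 : estOut v τ x = 0 := le_antisymm (not_lt.1 h) zero_le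
        unfold estOut at h0
        rw [Finset.sum_eq_zero_iff] at h0
        exact h0 z (by simpa using hz')
    simp [this]
  · rw [← NNReal.coe_mul, mul_inv_cancel_left₀ hβ]

/-! ### The entropy inequality along one segment -/

theorem AbsolutelyContinuousOnInterval.finset_sum {ι : Type*} (s : Finset ι) (f : ι → ℝ → ℝ)
    {a b : ℝ} (h : ∀ i ∈ s, AbsolutelyContinuousOnInterval (f i) a b) :
    AbsolutelyContinuousOnInterval (fun t => ∑ i ∈ s, f i t) a b := by
  classical
  induction s using Finset.induction_on with
  | empty =>
    simpa using (contDiff_const (c := (0 : ℝ))).contDiffOn.absolutelyContinuousOnInterval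
  | insert i s hi ih =>
    simp only [Finset.sum_insert hi]
    exact (h i (Finset.mem_insert_self i s)).add
      (ih fun j hj => h j (Finset.mem_insert_of_mem hj))

theorem ofReal_integral_le_lintegral {α : Type*} [MeasurableSpace α] {μ : Measure α} {g : α → ℝ}
    (hg : Integrable g μ) :
    ENNReal.ofReal (∫ x, g x ∂μ) ≤ ∫⁻ x, ENNReal.ofReal (g x) ∂μ := by
  have h : ∫ x, g x ∂μ ≤ ∫ x, max (g x) 0 ∂μ :=
    integral_mono hg hg.pos_part fun x => le_max_left _ _
  refine (ENNReal.ofReal_le_ofReal h).trans (le_of_eq ?_)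
  rw [ofReal_integral_eq_lintegral_ofReal hg.pos_part
    (Filter.Eventually.of_forall fun x => le_max_right _ _)]
  refine lintegral_congr fun x => ?_
  simp [ENNReal.ofReal_max]

theorem contDiff_siteKer (a c : Fin K) : ContDiff ℝ 1 fun s => siteKer s a c := by
  unfold siteKer
  split_ifs <;> fun_prop

theorem contDiff_fwdKer (x y : Seq K d) : ContDiff ℝ 1 fun s => fwdKer s x y :=
  contDiff_prod fun i _ => contDiff_siteKer (x i) (y i)

theorem contDiff_fwdMarginal (q : PMF (Seq K d)) (x : Seq K d) :
    ContDiff ℝ 1 fun s => fwdMarginal q s x := by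
  simp only [fwdMarginal_eq]
  exact ContDiff.sum fun y _ => (contDiff_fwdKer x y).mul contDiff_const

/-- The generator and its adjoint combine to the jump rates of the reverse process. -/
theorem sum_drift_eq (k q L : Seq K d → ℝ) :
    ∑ x, ((∑ w, k w * fwdGen K d w x) * q x - k x * ∑ y, fwdGen K d x y * q y) * L x =
      ∑ w, k w * ∑ x ∈ Finset.univ.filter (fun x => x ≠ w),
        (fwdRate w x : ℝ) * q x * (L x - L w) := by
  have h1 : ∀ w, ∑ x ∈ Finset.univ.filter (fun x => x ≠ w),
      (fwdRate w x : ℝ) * q x * (L x - L w) = ∑ x, fwdGen K d w x * q x * (L x - L w) := by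
    intro w
    rw [← Finset.sum_filter_add_sum_filter_not Finset.univ (fun z => z ≠ w)]
    have h2 : ∑ z ∈ Finset.univ.filter (fun z => ¬ z ≠ w),
        fwdGen K d w z * q z * (L z - L w) = 0 := by
      refine Finset.sum_eq_zero fun z hz => ?_
      have : z = w := by simpa using hz
      simp [this]
    rw [h2, add_zero]
    refine Finset.sum_congr rfl fun z hz => ?_
    have hz' : w ≠ z := Ne.symm (by simpa using hz)
    simp [fwdGen, hz']
  simp only [h1]
  simp only [mul_sub, Finset.sum_sub_distrib, sub_mul, Finset.mul_sum, Finset.sum_mul]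
  congr 1
  · rw [Finset.sum_comm]
    refine Finset.sum_congr rfl fun w _ => Finset.sum_congr rfl fun x _ => by ring
  · refine Finset.sum_congr rfl fun w _ => Finset.sum_congr rfl fun x _ => by ring

/-- Along one segment, the mean under the reverse process of the logarithm of the value function
increases by at most the score entropy spent on the segment. -/
theorem exists_segment_value (q : PMF (Seq K d)) (hq : ∀ y, q y ≠ 0 → numMask y = 0)
    {v : ℝ → Seq K d → Seq K d → ℝ≥0} (hv : ∀ y' y, Measurable fun t => v t y' y)
    {T a b : ℝ} (hab : a < b) (hbT : b < T) {f : Seq K d → ℝ} {m M : ℝ} (hm : 0 < m)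
    (hmf : ∀ y, m ≤ f y) (hfM : ∀ y, f y ≤ M) :
    ∃ g : Seq K d → ℝ, (∀ y, m ≤ g y) ∧ (∀ y, g y ≤ M) ∧
      (∀ x, ∫⁻ w, ENNReal.ofReal (f w.1) ∂(segment v T a b x) = ENNReal.ofReal (g x.1)) ∧
      ENNReal.ofReal (∑ x, fwdMarginal q (T - b) x * Real.log (f x) -
        ∑ x, fwdMarginal q (T - a) x * Real.log (g x)) ≤
      ∫⁻ t in Set.Ioc a b, lossDensity q v T t := by
  choose W hWm hWL hWd hWb hWa using fun z : Seq K d =>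
    exists_backward_solution hv (beta T b z) hab hm hmf hfM
  have hba : 0 < b - a := sub_pos.2 hab
  have haI : a ∈ Set.Icc a b := Set.left_mem_Icc.2 hab.le
  have hWpos : ∀ z, ∀ t ∈ Set.Icc a b, ∀ y, 0 < W z t y := fun z t ht y =>
    hm.trans_le (hWm z t ht y)
  set g : Seq K d → ℝ := fun z => Real.exp (-(beta T b z * (b - a))) * W z a z with hg
  have hgseg : ∀ x, ∫⁻ w, ENNReal.ofReal (f w.1) ∂(segment v T a b x) =
      ENNReal.ofReal (g x.1) := by
    intro x
    rw [lintegral_segment_fst hv T hab x (fun y => ENNReal.ofReal (f y)), ← hWa,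
      ← ENNReal.ofReal_mul (Real.exp_nonneg _)]
  have hgpos : ∀ z, 0 < g z := fun z => mul_pos (Real.exp_pos _) (hWpos z a haI z)
  have hM : 0 < M := hm.trans_le ((hmf (fun _ => mask K)).trans (hfM _))
  have hgm : ∀ z, m ≤ g z := by
    intro z
    have := isProbabilityMeasure_segment hv T hab (z, 0)
    rw [← ENNReal.ofReal_le_ofReal_iff (hgpos z).le, ← hgseg (z, 0)]
    calc ENNReal.ofReal m = ∫⁻ _, ENNReal.ofReal m ∂(segment v T a b (z, 0)) := by simp
      _ ≤ _ := lintegral_mono fun w => ENNReal.ofReal_le_ofReal (hmf _)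
  have hgM : ∀ z, g z ≤ M := by
    intro z
    have := isProbabilityMeasure_segment hv T hab (z, 0)
    rw [← ENNReal.ofReal_le_ofReal_iff hM.le, ← hgseg (z, 0)]
    calc _ ≤ ∫⁻ _, ENNReal.ofReal M ∂(segment v T a b (z, 0)) :=
          lintegral_mono fun w => ENNReal.ofReal_le_ofReal (hfM _)
      _ = _ := by simp
  refine ⟨g, hgm, hgM, hgseg, ?_⟩
  -- The mean of the logarithm of the value function under the law at time `t` of the reverse
  -- process, jointly with its state `z` at the time `a`, on which the threshold depends.
  set G : ℝ → ℝ := fun t => ∑ z, ∑ x, fwdKer (t - a) z x * fwdMarginal q (T - t) x *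
    (Real.log (W z t x) - beta T b z * (b - t)) with hG
  have hGb : G b = ∑ x, fwdMarginal q (T - b) x * Real.log (f x) := by
    simp only [hG, hWb, sub_self, mul_zero, sub_zero]
    rw [Finset.sum_comm]
    refine Finset.sum_congr rfl fun x _ => ?_
    simp only [mul_assoc]
    rw [← Finset.sum_mul, sum_fwdKer, one_mul]
  have hGa : G a = ∑ x, fwdMarginal q (T - a) x * Real.log (g x) := by
    simp only [hG, sub_self, fwdKer_zero]
    refine Finset.sum_congr rfl fun z _ => ?_
    rw [Finset.sum_eq_single z]
    · rw [if_pos rfl, one_mul, hg]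
      simp only
      rw [Real.log_mul (Real.exp_ne_zero _) (hWpos z a haI z).ne', Real.log_exp]
      ring
    · intro x _ hx
      simp [Ne.symm hx]
    · simp
  have hAC : AbsolutelyContinuousOnInterval G a b := by
    refine AbsolutelyContinuousOnInterval.finset_sum _ _ fun z _ =>
      AbsolutelyContinuousOnInterval.finset_sum _ _ fun x _ => ?_
    refine AbsolutelyContinuousOnInterval.mul (f := fun t => fwdKer (t - a) z x *
      fwdMarginal q (T - t) x) (g := fun t => Real.log (W z t x) - beta T b z * (b - t)) ?_ ?_
    · refine ContDiffOn.absolutelyContinuousOnInterval (ContDiff.contDiffOn ?_)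
      exact ((contDiff_fwdKer z x).comp (contDiff_id.sub contDiff_const)).mul
        ((contDiff_fwdMarginal q x).comp (contDiff_const.sub contDiff_id))
    · refine AbsolutelyContinuousOnInterval.sub (f := fun t => Real.log (W z t x))
        (g := fun t => beta T b z * (b - t)) ?_ ?_
      · obtain ⟨C, hC⟩ := hWL z x
        refine LipschitzOnWith.absolutelyContinuousOnInterval (K := C / m.toNNReal) ?_
        rw [Set.uIcc_of_le hab.le]
        have key : ∀ s ∈ Set.Icc a b, ∀ t ∈ Set.Icc a b,
            Real.log (W z s x) - Real.log (W z t x) ≤ C / m * dist s t := by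
          intro s hs t ht
          have hs0 := hWpos z s hs x
          have ht0 := hWpos z t ht x
          rw [← Real.log_div hs0.ne' ht0.ne']
          refine (Real.log_le_sub_one_of_pos (by positivity)).trans ?_
          have h1 : W z s x - W z t x ≤ C * dist s t :=
            (le_abs_self _).trans (hC.dist_le_mul s hs t ht)
          rw [div_sub_one ht0.ne', div_mul_eq_mul_div]
          calc (W z s x - W z t x) / W z t x ≤ C * dist s t / W z t x := by gcongr
            _ ≤ C * dist s t / m := by gcongr; exact hWm z t ht x
        refine LipschitzOnWith.of_dist_le_mul fun s hs t ht => ?_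
        rw [NNReal.coe_div, Real.coe_toNNReal _ hm.le, Real.dist_eq, abs_le]
        have h1 := key s hs t ht
        have h2 := key t ht s hs
        rw [dist_comm] at h2
        exact ⟨by linarith, h1⟩
      · exact ContDiffOn.absolutelyContinuousOnInterval (ContDiff.contDiffOn (by fun_prop))
  have hderiv : ∀ᵐ t, t ∈ Set.Ioo a b → ENNReal.ofReal (deriv G t) ≤ lossDensity q v T t := by
    filter_upwards [ae_all_iff.2 hWd] with t ht htI
    have htc : t ∈ Set.Icc a b := Set.Ioo_subset_Icc_self htI
    have htT : t < T := htI.2.trans hbT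
    have hT0 : 0 < T - t := sub_pos.2 htT
    have hta : 0 ≤ t - a := (sub_pos.2 htI.1).le
    -- The derivative of `G`, with the terms of the two generators collected.
    have hGd : HasDerivAt G (∑ z, ∑ w, fwdKer (t - a) z w * (fwdMarginal q (T - t) w *
        ∑ y ∈ Finset.univ.filter (fun y => y ≠ w), (fwdRate w y * trueScore q T t w y *
          (Real.log (W z t y) - Real.log (W z t w)) - truncRate v (beta T b z) t y w *
          (Real.exp (Real.log (W z t y) - Real.log (W z t w)) - 1)))) t := by
      refine HasDerivAt.fun_sum fun z _ => ?_
      have hterm : ∀ x, HasDerivAt (fun r => fwdKer (r - a) z x * fwdMarginal q (T - r) x *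
          (Real.log (W z r x) - beta T b z * (b - r)))
          (((∑ w, fwdKer (t - a) z w * fwdGen K d w x) * fwdMarginal q (T - t) x -
            fwdKer (t - a) z x * ∑ y, fwdGen K d x y * fwdMarginal q (T - t) y) *
            (Real.log (W z t x) - beta T b z * (b - t)) +
            fwdKer (t - a) z x * fwdMarginal q (T - t) x *
            (-∑ y ∈ Finset.univ.filter (fun y => y ≠ x), (truncRate v (beta T b z) t y x *
              (Real.exp (Real.log (W z t y) - Real.log (W z t x)) - 1)))) t := by
        intro x
        have h1 : HasDerivAt (fun r => fwdKer (r - a) z x)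
            (∑ w, fwdKer (t - a) z w * fwdGen K d w x) t := by
          exact (hasDerivAt_fwdKer_right (t - a) z x).comp_sub_const t a
        have h2 : HasDerivAt (fun r => fwdMarginal q (T - r) x)
            (-∑ y, fwdGen K d x y * fwdMarginal q (T - t) y) t := by
          exact (hasDerivAt_fwdMarginal q (T - t) x).comp_const_sub T t
        have h3 := (ht z htI x).log (hWpos z t htc x).ne'
        have h4 : HasDerivAt (fun r => (beta T b z : ℝ) * (b - r)) (-(beta T b z : ℝ)) t := by
          simpa using ((hasDerivAt_id t).const_sub b).const_mul (beta T b z : ℝ)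
        refine ((h1.mul h2).mul (h3.sub h4)).congr_deriv ?_
        have hx := (hWpos z t htc x).ne'
        have h5 : -(beta T b z * ∑ y, (stepProb v (beta T b z) t x y : ℝ) * W z t y) / W z t x -
            -(beta T b z : ℝ) = -∑ y ∈ Finset.univ.filter (fun y => y ≠ x),
              (truncRate v (beta T b z) t y x *
              (Real.exp (Real.log (W z t y) - Real.log (W z t x)) - 1)) := by
          rw [coe_mul_sum_stepProb]
          have h6 : ∑ y ∈ Finset.univ.filter (fun y => y ≠ x),
              (truncRate v (beta T b z) t y x *
              (Real.exp (Real.log (W z t y) - Real.log (W z t x)) - 1)) =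
              (∑ y ∈ Finset.univ.filter (fun y => y ≠ x),
              (truncRate v (beta T b z) t y x : ℝ) * (W z t y - W z t x)) / W z t x := by
            rw [Finset.sum_div]
            refine Finset.sum_congr rfl fun y _ => ?_
            rw [Real.exp_sub, Real.exp_log (hWpos z t htc y), Real.exp_log (hWpos z t htc x)]
            field_simp
          rw [h6]
          field_simp
          ring
        rw [h5]
        simp only [Pi.mul_apply, Pi.sub_apply]
        ring
      refine (HasDerivAt.fun_sum fun x _ => hterm x).congr_deriv ?_
      rw [Finset.sum_add_distrib, sum_drift_eq, ← Finset.sum_add_distrib]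
      refine Finset.sum_congr rfl fun w _ => ?_
      rw [mul_assoc, ← mul_add]
      congr 1
      rw [mul_neg, ← sub_eq_add_neg, Finset.mul_sum, Finset.mul_sum, ← Finset.sum_sub_distrib]
      refine Finset.sum_congr rfl fun y hy => ?_
      have hy' : y ≠ w := by simpa using hy
      by_cases hw : fwdMarginal q (T - t) w = 0
      · rw [fwdRate_mul_fwdMarginal_eq_zero q hq hT0 hy' hw, hw]
        ring
      · unfold trueScore revMarginal
        field_simp
        ring
    rw [hGd.deriv]
    have hker : ∀ w : Seq K d, ∑ z, ENNReal.ofReal (fwdKer (t - a) z w) = 1 := by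
      intro w
      rw [← ENNReal.ofReal_sum_of_nonneg fun z _ => fwdKer_nonneg hta z w, sum_fwdKer,
        ENNReal.ofReal_one]
    calc _ ≤ ∑ z, ∑ w, ENNReal.ofReal (fwdKer (t - a) z w) *
          (ENNReal.ofReal (fwdMarginal q (T - t) w) *
          ∑ y ∈ Finset.univ.filter (fun y => y ≠ w),
            (fwdRate w y : ℝ≥0∞) * bregman (trueScore q T t w y) (v t w y)) := by
          refine (ofReal_sum_le_sum_ofReal _ _).trans (Finset.sum_le_sum fun z _ =>
            (ofReal_sum_le_sum_ofReal _ _).trans (Finset.sum_le_sum fun w _ => ?_))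
          rw [ENNReal.ofReal_mul (fwdKer_nonneg hta z w),
            ENNReal.ofReal_mul (fwdMarginal_nonneg q hT0.le w)]
          by_cases hk : fwdKer (t - a) z w = 0
          · simp [hk]
          by_cases hw : fwdMarginal q (T - t) w = 0
          · simp [hw]
          gcongr
          refine ofReal_drift_le q hq v htT (beta T b z) w ?_ hw _
          -- The reverse process only unmasks, so the threshold of the initial state `z` bounds the
          -- true rates during the whole segment.
          have hnum : (numMask w : ℝ) ≤ numMask z := by
            exact_mod_cast numMask_le_of_fwdKer_ne_zero hk
          have hexp : Real.exp (T - b) ≤ Real.exp (T - t) :=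
            Real.exp_le_exp.2 (by linarith [htI.2])
          have hexp1 : 0 < Real.exp (T - b) - 1 := by
            have := Real.add_one_lt_exp (sub_pos.2 hbT).ne'
            linarith
          have hK : (1 : ℝ) ≤ K := by exact_mod_cast NeZero.one_le
          unfold beta
          refine le_trans ?_ (Real.le_coe_toNNReal _)
          have hz0 : (0 : ℝ) ≤ numMask z := Nat.cast_nonneg _
          gcongr
          nlinarith
      _ = lossDensity q v T t := by
          rw [Finset.sum_comm]
          refine Finset.sum_congr rfl fun w _ => ?_
          rw [← Finset.sum_mul, hker, one_mul]
  rw [← hGb, ← hGa, ← hAC.integral_deriv_eq_sub, intervalIntegral.integral_of_le hab.le]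
  have hint := hAC.intervalIntegrable_deriv
  rw [intervalIntegrable_iff_integrableOn_Ioc_of_le hab.le] at hint
  refine (ofReal_integral_le_lintegral hint).trans (lintegral_mono_ae ?_)
  rw [Measure.restrict_congr_set Ioo_ae_eq_Ioc.symm, ae_restrict_iff' measurableSet_Ioo]
  exact hderiv

/-! ### The entropy inequality for the sampler -/

theorem lintegral_lossDensity (q : PMF (Seq K d)) (v : ℝ → Seq K d → Seq K d → ℝ≥0) {T : ℝ}
    (hT : 0 < T) :
    ∫⁻ t in Set.Icc 0 T, lossDensity q v T t = ENNReal.ofReal T * scoreEntropy q T v := by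
  have hT0 : ENNReal.ofReal T ≠ 0 := by simpa using hT
  rw [scoreEntropy, ← mul_assoc, ENNReal.mul_inv_cancel hT0 ENNReal.ofReal_ne_top, one_mul]
  rw [← lintegral_indicator measurableSet_Icc, ← lintegral_indicator measurableSet_Icc,
    ← lintegral_sub_left_eq_self _ T]
  refine lintegral_congr fun t => ?_
  have hiff : T - t ∈ Set.Icc 0 T ↔ t ∈ Set.Icc 0 T := by
    constructor <;> rintro ⟨h1, h2⟩ <;> constructor <;> linarith
  by_cases ht : t ∈ Set.Icc 0 T
  · rw [Set.indicator_of_mem ht, Set.indicator_of_mem (hiff.2 ht), lossDensity, sub_sub_cancel]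
  · rw [Set.indicator_of_notMem ht, Set.indicator_of_notMem fun h => ht (hiff.1 h)]

theorem partition_le {p : ℕ → ℝ} {w i : ℕ} (hp : ∀ i < w, p i < p (i + 1)) (hi : i ≤ w) :
    p i ≤ p w := by
  induction w, hi using Nat.le_induction with
  | base => exact le_rfl
  | succ n _ ih =>
    exact (ih fun j hj => hp j (hj.trans n.lt_succ_self)).trans (hp n n.lt_succ_self).le

/-- The entropy inequality between the reverse process and the sampler, in its dual form: `f` is
a test function, and the initial law of the reverse process enters through the all-mask state. -/
theorem exists_sampler_mean (q : PMF (Seq K d)) (hq : ∀ y, q y ≠ 0 → numMask y = 0)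
    {v : ℝ → Seq K d → Seq K d → ℝ≥0} (hv : ∀ y' y, Measurable fun t => v t y' y)
    {T : ℝ} (p : ℕ → ℝ) (w : ℕ) (hp : ∀ i < w, p i < p (i + 1)) (hpT : p w < T) (hp0 : p 0 = 0)
    {f : Seq K d → ℝ} {m M : ℝ} (hm : 0 < m) (hmf : ∀ y, m ≤ f y) (hfM : ∀ y, f y ≤ M) :
    ∃ E : ℝ, m ≤ E ∧ E ≤ M ∧
      ∫⁻ x, ENNReal.ofReal (f x.1) ∂(samplerLaw v T p w) = ENNReal.ofReal E ∧
      ENNReal.ofReal (∑ x, fwdMarginal q (T - p w) x * Real.log (f x) -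
        (fwdMarginal q T (fun _ => mask K) * Real.log E +
          (1 - fwdMarginal q T (fun _ => mask K)) * Real.log M)) ≤
      ∫⁻ t in Set.Ioc 0 (p w), lossDensity q v T t := by
  induction w generalizing f with
  | zero =>
    refine ⟨f fun _ => mask K, hmf _, hfM _, ?_, ?_⟩
    · rw [samplerLaw, lintegral_dirac]
    · rw [hp0, sub_zero, ENNReal.ofReal_of_nonpos]
      · exact zero_le
      have hT0 : 0 ≤ T := by rw [hp0] at hpT; exact hpT.le
      set o : Seq K d := fun _ => mask K with ho
      have hsum := sum_fwdMarginal q T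
      rw [← Finset.add_sum_erase _ _ (Finset.mem_univ o)] at hsum ⊢
      have h1 : ∑ x ∈ Finset.univ.erase o, fwdMarginal q T x * Real.log (f x) ≤
          ∑ x ∈ Finset.univ.erase o, fwdMarginal q T x * Real.log M :=
        Finset.sum_le_sum fun x _ => mul_le_mul_of_nonneg_left
          (Real.log_le_log (hm.trans_le (hmf x)) (hfM x)) (fwdMarginal_nonneg q hT0 x)
      rw [← Finset.sum_mul] at h1
      have h2 : ∑ x ∈ Finset.univ.erase o, fwdMarginal q T x = 1 - fwdMarginal q T o := by
        linarith
      rw [h2] at h1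
      linarith
  | succ w ih =>
    have hlt := hp w w.lt_succ_self
    obtain ⟨g, hmg, hgM, hseg, hloss⟩ := exists_segment_value q hq hv hlt hpT hm hmf hfM
    obtain ⟨E, hmE, hEM, hE, hlossE⟩ := ih (fun i hi => hp i (hi.trans w.lt_succ_self))
      (hlt.trans hpT) hmg hgM
    refine ⟨E, hmE, hEM, ?_, ?_⟩
    · rw [samplerLaw, Measure.lintegral_bind Measurable.of_discrete.aemeasurable
        Measurable.of_discrete.aemeasurable, ← hE]
      exact lintegral_congr hseg
    · have hmono : 0 ≤ p w :=
        hp0.ge.trans (partition_le (fun i hi => hp i (hi.trans w.lt_succ_self)) w.zero_le)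
      rw [← Set.Ioc_union_Ioc_eq_Ioc hmono hlt.le,
        lintegral_union measurableSet_Ioc (Set.Ioc_disjoint_Ioc_of_le le_rfl)]
      refine le_trans (le_trans (ENNReal.ofReal_le_ofReal (le_of_eq ?_))
        ENNReal.ofReal_add_le) (add_le_add hlossE hloss)
      ring

/-- The dual form of the bound of the relative entropy of the reverse process with respect to the
sampler: a variational (Donsker-Varadhan) inequality for the test function `log f`. The initial
states other than the all-mask state are accounted for by the upper bound `M` of `f`. -/
theorem sampler_log_inequality (q : PMF (Seq K d)) (hq : ∀ y, q y ≠ 0 → numMask y = 0)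
    {v : ℝ → Seq K d → Seq K d → ℝ≥0} (hv : ∀ y' y, Measurable fun t => v t y' y)
    {T L : ℝ} (hL : 0 ≤ L) (hloss : ENNReal.ofReal T * scoreEntropy q T v ≤ ENNReal.ofReal L)
    (p : ℕ → ℝ) (w : ℕ) (hp : ∀ i < w, p i < p (i + 1)) (hpT : p w < T) (hp0 : p 0 = 0)
    (hT : 0 < T) {f : Seq K d → ℝ} {m M : ℝ} (hm : 0 < m) (hmf : ∀ y, m ≤ f y)
    (hfM : ∀ y, f y ≤ M) :
    ∑ x, fwdMarginal q (T - p w) x * Real.log (f x) ≤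
      fwdMarginal q T (fun _ => mask K) * Real.log (∫ x, f x.1 ∂(samplerLaw v T p w)) +
        (1 - fwdMarginal q T (fun _ => mask K)) * Real.log M + L := by
  obtain ⟨E, hmE, hEM, hE, h⟩ := exists_sampler_mean q hq hv p w hp hpT hp0 hm hmf hfM
  have hEint : ∫ x, f x.1 ∂(samplerLaw v T p w) = E := by
    rw [integral_eq_lintegral_of_nonneg_ae (f := fun x : Seq K d × ℕ => f x.1)
      (Filter.Eventually.of_forall fun x => hm.le.trans (hmf x.1))
      Measurable.of_discrete.aestronglyMeasurable, hE, ENNReal.toReal_ofReal (hm.le.trans hmE)]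
  rw [hEint]
  have h2 : ∫⁻ t in Set.Ioc 0 (p w), lossDensity q v T t ≤ ENNReal.ofReal L := by
    refine le_trans (lintegral_mono_set ?_) ((lintegral_lossDensity q v hT).trans_le hloss)
    exact fun t ht => ⟨ht.1.le, ht.2.trans hpT.le⟩
  have h3 := (ENNReal.ofReal_le_ofReal_iff hL).1 (h.trans h2)
  linarith

/-! ### Means under the sampler -/

theorem integrable_fst {k n : ℕ} {μ : Measure (Seq k n × ℕ)} [IsFiniteMeasure μ]
    (f : Seq k n → ℝ) :
    Integrable (fun x => f x.1) μ := by
  refine Integrable.of_bound (C := ∑ y, |f y|)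
    Measurable.of_discrete.aestronglyMeasurable (Filter.Eventually.of_forall fun x => ?_)
  exact Finset.single_le_sum (f := fun y => |f y|) (fun y _ => abs_nonneg _) (Finset.mem_univ x.1)

/-- Hoeffding's lemma for a function of the state with values in `[0, 1]`. -/
theorem log_integral_exp_le {k n : ℕ} {μ : Measure (Seq k n × ℕ)} [IsProbabilityMeasure μ]
    {g : Seq k n → ℝ} (hg0 : ∀ y, 0 ≤ g y) (hg1 : ∀ y, g y ≤ 1) (t : ℝ) :
    Real.log (∫ x, Real.exp (t * g x.1) ∂μ) ≤ t * ∫ x, g x.1 ∂μ + t ^ 2 / 8 := by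
  have hsub := hasSubgaussianMGF_of_mem_Icc (μ := μ) (X := fun x => g x.1) (a := 0) (b := 1)
    Measurable.of_discrete.aemeasurable
    (Filter.Eventually.of_forall fun x => ⟨hg0 x.1, hg1 x.1⟩)
  have h := hsub.mgf_le t
  have hpos : 0 < ∫ x, Real.exp (t * g x.1) ∂μ :=
    integral_exp_pos (integrable_fst fun y => Real.exp (t * g y))
  have hmgf : mgf (fun x => g x.1 - μ[fun x => g x.1]) μ t =
      (∫ x, Real.exp (t * g x.1) ∂μ) * Real.exp (-(t * ∫ x, g x.1 ∂μ)) := by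
    rw [mgf, ← integral_mul_const]
    refine integral_congr_ae (Filter.Eventually.of_forall fun x => ?_)
    simp only [← Real.exp_add]
    congr 1
    ring
  rw [hmgf] at h
  have h2 : ∫ x, Real.exp (t * g x.1) ∂μ ≤ Real.exp (t * ∫ x, g x.1 ∂μ + t ^ 2 / 8) := by
    have h3 := mul_le_mul_of_nonneg_right h (Real.exp_pos (t * ∫ x, g x.1 ∂μ)).le
    rw [mul_assoc, ← Real.exp_add, neg_add_cancel, Real.exp_zero, mul_one, ← Real.exp_add] at h3
    refine h3.trans (le_of_eq ?_)
    congr 1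
    norm_num
    ring
  exact (Real.log_le_iff_le_exp hpos).2 h2

theorem fwdMarginal_le_one (q : PMF (Seq K d)) {s : ℝ} (hs : 0 ≤ s) (x : Seq K d) :
    fwdMarginal q s x ≤ 1 := by
  rw [← sum_fwdMarginal q s]
  exact Finset.single_le_sum (fun y _ => fwdMarginal_nonneg q hs y) (Finset.mem_univ x)

/-- The mean of a test function under the reverse process exceeds the mean under the sampler by a
Pinsker-type error, plus the initial mass off the all-mask state. -/
theorem sum_fwdMarginal_mul_le (q : PMF (Seq K d)) (hq : ∀ y, q y ≠ 0 → numMask y = 0)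
    {v : ℝ → Seq K d → Seq K d → ℝ≥0} (hv : ∀ y' y, Measurable fun t => v t y' y)
    {T L : ℝ} (hL : 0 ≤ L) (hloss : ENNReal.ofReal T * scoreEntropy q T v ≤ ENNReal.ofReal L)
    (p : ℕ → ℝ) (w : ℕ) (hp : ∀ i < w, p i < p (i + 1)) (hpT : p w < T) (hp0 : p 0 = 0)
    (hT : 0 < T) {g : Seq K d → ℝ} (hg0 : ∀ y, 0 ≤ g y) (hg1 : ∀ y, g y ≤ 1) {t : ℝ}
    (ht : 0 < t) :
    ∑ x, fwdMarginal q (T - p w) x * g x ≤ (∫ x, g x.1 ∂(samplerLaw v T p w)) +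
      (t / 8 + L / t + (1 - fwdMarginal q T (fun _ => mask K))) := by
  have := isProbabilityMeasure_samplerLaw hv T p w hp
  have h := sampler_log_inequality q hq hv hL hloss p w hp hpT hp0 hT
    (f := fun y => Real.exp (t * g y)) (m := 1) (M := Real.exp t) one_pos
    (fun y => Real.one_le_exp (mul_nonneg ht.le (hg0 y)))
    (fun y => Real.exp_le_exp.2 (mul_le_of_le_one_right ht.le (hg1 y)))
  simp only [Real.log_exp] at h
  have hlog := log_integral_exp_le (μ := samplerLaw v T p w) hg0 hg1 t
  have hlog0 : 0 ≤ Real.log (∫ x, Real.exp (t * g x.1) ∂(samplerLaw v T p w)) := by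
    refine Real.log_nonneg ?_
    calc (1 : ℝ) = ∫ _, 1 ∂(samplerLaw v T p w) := by simp
      _ ≤ _ := integral_mono (integrable_const _) (integrable_fst fun y => Real.exp (t * g y))
        fun x => Real.one_le_exp (mul_nonneg ht.le (hg0 x.1))
  have ha1 := fwdMarginal_le_one q hT.le (fun _ => mask K)
  set a := fwdMarginal q T (fun _ => mask K)
  set I := ∫ x, g x.1 ∂(samplerLaw v T p w)
  have h1 : ∑ x, fwdMarginal q (T - p w) x * (t * g x) =
      t * ∑ x, fwdMarginal q (T - p w) x * g x := by
    rw [Finset.mul_sum]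
    exact Finset.sum_congr rfl fun x _ => by ring
  rw [h1] at h
  have h2 : t * ∑ x, fwdMarginal q (T - p w) x * g x ≤ t * (I + (t / 8 + L / t + (1 - a))) := by
    have h3 : t * (I + (t / 8 + L / t + (1 - a))) = t * I + t ^ 2 / 8 + L + (1 - a) * t := by
      field_simp
      ring
    rw [h3]
    nlinarith [mul_le_of_le_one_left hlog0 ha1]
  exact le_of_mul_le_mul_left h2 ht

/-- The mean of a test function under the sampler, bounded by the mean under the reverse process.
Here the initial mass `a` of the all-mask state enters multiplicatively. -/
theorem integral_samplerLaw_le (q : PMF (Seq K d)) (hq : ∀ y, q y ≠ 0 → numMask y = 0)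
    {v : ℝ → Seq K d → Seq K d → ℝ≥0} (hv : ∀ y' y, Measurable fun t => v t y' y)
    {T L : ℝ} (hL : 0 ≤ L) (hloss : ENNReal.ofReal T * scoreEntropy q T v ≤ ENNReal.ofReal L)
    (p : ℕ → ℝ) (w : ℕ) (hp : ∀ i < w, p i < p (i + 1)) (hpT : p w < T) (hp0 : p 0 = 0)
    (hT : 0 < T) {g : Seq K d → ℝ} (hg0 : ∀ y, 0 ≤ g y) (hg1 : ∀ y, g y ≤ 1) {t : ℝ}
    (ht : 0 < t) {a : ℝ} (ha : 0 < a) (haT : a ≤ fwdMarginal q T (fun _ => mask K)) :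
    ∫ x, g x.1 ∂(samplerLaw v T p w) ≤
      (∑ x, fwdMarginal q (T - p w) x * g x) / a + L / (a * t) + t / 8 := by
  have := isProbabilityMeasure_samplerLaw hv T p w hp
  have h := sampler_log_inequality q hq hv hL hloss p w hp hpT hp0 hT
    (f := fun y => Real.exp (-t * g y)) (m := Real.exp (-t)) (M := 1) (Real.exp_pos _)
    (fun y => Real.exp_le_exp.2 (by nlinarith [hg1 y]))
    (fun y => Real.exp_le_one_iff.2 (by nlinarith [hg0 y]))
  simp only [Real.log_exp, Real.log_one, mul_zero, add_zero] at h
  have hlog := log_integral_exp_le (μ := samplerLaw v T p w) hg0 hg1 (-t)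
  have hlog0 : Real.log (∫ x, Real.exp (-t * g x.1) ∂(samplerLaw v T p w)) ≤ 0 := by
    refine Real.log_nonpos (integral_nonneg fun x => (Real.exp_pos _).le) ?_
    calc _ ≤ ∫ _, (1 : ℝ) ∂(samplerLaw v T p w) :=
        integral_mono (integrable_fst fun y => Real.exp (-t * g y)) (integrable_const _)
          fun x => Real.exp_le_one_iff.2 (by nlinarith [hg0 x.1])
      _ = 1 := by simp
  set I := ∫ x, g x.1 ∂(samplerLaw v T p w)
  set l := Real.log (∫ x, Real.exp (-t * g x.1) ∂(samplerLaw v T p w))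
  set b := fwdMarginal q T (fun _ => mask K)
  have h1 : ∑ x, fwdMarginal q (T - p w) x * (-t * g x) =
      -t * ∑ x, fwdMarginal q (T - p w) x * g x := by
    rw [Finset.mul_sum]
    exact Finset.sum_congr rfl fun x _ => by ring
  rw [h1] at h
  set S := ∑ x, fwdMarginal q (T - p w) x * g x
  have h2 : b * l ≤ a * l := by nlinarith
  have h3 : a * l ≤ a * (-t * I + (-t) ^ 2 / 8) := mul_le_mul_of_nonneg_left hlog ha.le
  have h4 : a * t * I ≤ a * t * (S / a + L / (a * t) + t / 8) := by
    have : a * t * (S / a + L / (a * t) + t / 8) = t * S + L + a * t ^ 2 / 8 := by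
      field_simp
    rw [this]
    nlinarith
  exact le_of_mul_le_mul_left h4 (mul_pos ha ht)

/-! ### The number of score evaluations -/

/-- The mean fraction of masked coordinates after `w` segments. -/
def maskFrac (v : ℝ → Seq K d → Seq K d → ℝ≥0) (T : ℝ) (p : ℕ → ℝ) (w : ℕ) : ℝ :=
  ∫ x, (numMask x.1 : ℝ) / d ∂(samplerLaw v T p w)

theorem numMask_div_le_one (y : Seq K d) : (numMask y : ℝ) / d ≤ 1 := by
  refine div_le_one_of_le₀ ?_ (Nat.cast_nonneg _)
  have : numMask y ≤ d := by
    simpa [numMask] using Finset.card_le_univ (Finset.univ.filter fun i => y i = mask K)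
  exact_mod_cast this

theorem maskFrac_nonneg (v : ℝ → Seq K d → Seq K d → ℝ≥0) (T : ℝ) (p : ℕ → ℝ) (w : ℕ) :
    0 ≤ maskFrac v T p w :=
  integral_nonneg fun x => by positivity

theorem maskFrac_le_one {v : ℝ → Seq K d → Seq K d → ℝ≥0}
    (hv : ∀ y' y, Measurable fun t => v t y' y) (T : ℝ) (p : ℕ → ℝ) (w : ℕ)
    (hp : ∀ i < w, p i < p (i + 1)) : maskFrac v T p w ≤ 1 := by
  have := isProbabilityMeasure_samplerLaw hv T p w hp
  calc maskFrac v T p w ≤ ∫ _, (1 : ℝ) ∂(samplerLaw v T p w) :=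
        integral_mono (integrable_fst fun y => (numMask y : ℝ) / d) (integrable_const _)
          fun x => numMask_div_le_one x.1
    _ = 1 := by simp

/-- The mean number of score evaluations. -/
theorem lintegral_samplerLaw_snd {v : ℝ → Seq K d → Seq K d → ℝ≥0}
    (hv : ∀ y' y, Measurable fun t => v t y' y) (hd : d ≠ 0) (T : ℝ) (p : ℕ → ℝ) (w : ℕ)
    (hp : ∀ i < w, p i < p (i + 1)) (hpT : p w < T) :
    ∫⁻ x, (x.2 : ℝ≥0∞) ∂(samplerLaw v T p w) =
      ENNReal.ofReal (∑ i ∈ Finset.range w, K * d *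
        ((p (i + 1) - p i) * (maskFrac v T p i / (Real.exp (T - p (i + 1)) - 1)))) := by
  induction w with
  | zero => simp [samplerLaw, lintegral_dirac]
  | succ w ih =>
    have hlt := hp w w.lt_succ_self
    have hp' : ∀ i < w, p i < p (i + 1) := fun i hi => hp i (hi.trans w.lt_succ_self)
    have := isProbabilityMeasure_samplerLaw hv T p w hp'
    have hE : 0 < Real.exp (T - p (w + 1)) - 1 := by
      have := Real.add_one_lt_exp (sub_pos.2 hpT).ne'
      linarith
    rw [samplerLaw, Measure.lintegral_bind Measurable.of_discrete.aemeasurable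
      Measurable.of_discrete.aemeasurable]
    simp_rw [lintegral_segment_snd hv T hlt]
    rw [lintegral_add_left Measurable.of_discrete, ih hp' (hlt.trans hpT), Finset.sum_range_succ,
      ENNReal.ofReal_add]
    · congr 1
      rw [lintegral_mul_const _ Measurable.of_discrete]
      have hb : ∀ x : Seq K d × ℕ, (beta T (p (w + 1)) x.1 : ℝ≥0∞) =
          ENNReal.ofReal ((K * d / (Real.exp (T - p (w + 1)) - 1)) * ((numMask x.1 : ℝ) / d)) := by
        intro x
        rw [beta, ENNReal.ofReal]
        congr 2
        have : (d : ℝ) ≠ 0 := Nat.cast_ne_zero.2 hd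
        field_simp
      simp_rw [hb]
      rw [← ofReal_integral_eq_lintegral_ofReal
          (integrable_fst fun y => (K * d / (Real.exp (T - p (w + 1)) - 1)) * ((numMask y : ℝ) / d))
          (Filter.Eventually.of_forall fun x => by positivity), integral_const_mul, ← maskFrac,
        ← ENNReal.ofReal_mul (mul_nonneg (by positivity) (maskFrac_nonneg v T p w))]
      congr 1
      ring
    · refine Finset.sum_nonneg fun i hi => ?_
      have h1 := maskFrac_nonneg v T p i
      have h2 := hp' i (Finset.mem_range.1 hi)
      have h5 : 0 < T - p (i + 1) := by
        linarith [partition_le hp' (Finset.mem_range.1 hi)]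
      have h3 : 0 < Real.exp (T - p (i + 1)) - 1 := by
        linarith [Real.add_one_lt_exp h5.ne']
      have h4 := sub_pos.2 h2
      positivity
    · have h1 := maskFrac_nonneg v T p w
      have h4 := sub_pos.2 hlt
      positivity

/-! ### Sums over an equidistant partition -/

/-- The primitive of `e⁻²ˢ / (1 - e⁻ˢ)` that vanishes at infinity. -/
def tailPrim (s : ℝ) : ℝ := Real.log (1 - Real.exp (-s)) + Real.exp (-s)

theorem tailPrim_mono {r s : ℝ} (hr : 0 < r) (hrs : r ≤ s) : tailPrim r ≤ tailPrim s := by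
  have h1 : Real.exp (-r) < 1 := Real.exp_lt_one_iff.2 (by linarith)
  have h2 : Real.exp (-s) ≤ Real.exp (-r) := Real.exp_le_exp.2 (by linarith)
  have h3 := Real.exp_pos (-s)
  unfold tailPrim
  set x := Real.exp (-r)
  set y := Real.exp (-s)
  have h := Real.log_le_sub_one_of_pos (x := (1 - x) / (1 - y))
    (div_pos (by linarith) (by linarith))
  rw [Real.log_div (by linarith) (by linarith)] at h
  have h4 : (1 - x) / (1 - y) - 1 ≤ y - x := by
    rw [div_sub_one (by linarith), div_le_iff₀ (by linarith)]
    nlinarith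
  linarith

theorem tailPrim_nonpos {s : ℝ} (hs : 0 < s) : tailPrim s ≤ 0 := by
  have h1 : Real.exp (-s) < 1 := Real.exp_lt_one_iff.2 (by linarith)
  have h := Real.log_le_sub_one_of_pos (x := 1 - Real.exp (-s)) (by linarith)
  unfold tailPrim
  linarith

/-- The midpoint rule underestimates the integral of a convex function: here of `e⁻ˢ`. -/
theorem midpoint_exp {h : ℝ} (hh : 0 ≤ h) (s : ℝ) :
    2 * h * Real.exp (-s) ≤ -Real.exp (-(s + h)) - -Real.exp (-(s - h)) := by
  have h1 : Real.exp (-(s + h)) = Real.exp (-s) * Real.exp (-h) := by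
    rw [← Real.exp_add]; congr 1; ring
  have h2 : Real.exp (-(s - h)) = Real.exp (-s) * Real.exp h := by
    rw [← Real.exp_add]; congr 1; ring
  have h3 := Real.self_le_sinh_iff.2 hh
  rw [Real.sinh_eq] at h3
  rw [h1, h2]
  nlinarith [Real.exp_pos (-s)]

/-- The midpoint rule for `e⁻²ˢ / (1 - e⁻ˢ)`. -/
theorem midpoint_tail {h s : ℝ} (hh : 0 < h) (hs : h < s) :
    2 * h * (Real.exp (-s) ^ 2 / (1 - Real.exp (-s))) ≤ tailPrim (s + h) - tailPrim (s - h) := by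
  have h1 : Real.exp (-(s + h)) = Real.exp (-s) * Real.exp (-h) := by
    rw [← Real.exp_add]; congr 1; ring
  have h2 : Real.exp (-(s - h)) = Real.exp (-s) * Real.exp h := by
    rw [← Real.exp_add]; congr 1; ring
  have hsinh := Real.self_le_sinh_iff.2 hh.le
  have hcosh := Real.one_le_cosh h
  have h3 : Real.exp h = Real.cosh h + Real.sinh h := (Real.cosh_add_sinh h).symm
  have h4 : Real.exp (-h) = Real.cosh h - Real.sinh h := (Real.cosh_sub_sinh h).symm
  have h5 : Real.exp (-(s - h)) < 1 := Real.exp_lt_one_iff.2 (by linarith)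
  unfold tailPrim
  rw [h2, h3] at h5
  rw [h1, h2, h3, h4]
  set x := Real.exp (-s) with hx
  have hx0 : 0 < x := Real.exp_pos _
  set S := Real.sinh h
  set C := Real.cosh h
  have hS : 0 < S := hh.trans_le hsinh
  have hxS : 0 < x * S := mul_pos hx0 hS
  have hden : 0 < 1 - x * (C + S) := by linarith
  have hden2 : 0 < 1 - x * C := by nlinarith
  have hden3 : 0 < 1 - x := by nlinarith
  have hlog := Real.le_log_one_add_of_nonneg (x := 2 * (x * S) / (1 - x * (C + S)))
    (div_nonneg (by linarith) hden.le)
  have e1 : 1 + 2 * (x * S) / (1 - x * (C + S)) = (1 - x * (C - S)) / (1 - x * (C + S)) := by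
    field_simp
    ring
  have e2 : 2 * (2 * (x * S) / (1 - x * (C + S))) / (2 * (x * S) / (1 - x * (C + S)) + 2) =
      2 * (x * S) / (1 - x * C) := by
    have : 2 * (x * S) / (1 - x * (C + S)) + 2 = 2 * (1 - x * C) / (1 - x * (C + S)) := by
      field_simp
      ring
    rw [this]
    field_simp
  rw [e1, e2, Real.log_div (by nlinarith) hden.ne'] at hlog
  have hmain : 2 * h * (x ^ 2 / (1 - x)) ≤ 2 * (x * S) / (1 - x * C) - 2 * (x * S) := by
    have : 2 * (x * S) / (1 - x * C) - 2 * (x * S) = 2 * S * (x ^ 2 * C / (1 - x * C)) := by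
      field_simp
      ring
    rw [this]
    gcongr
    · nlinarith
    · nlinarith
  linarith

/-- Telescoping of the midpoint rule with `n` steps of length `2 h`, the first midpoint being
`s`. -/
theorem sum_le_of_midpoint {F G : ℝ → ℝ} {h s : ℝ}
    (hFG : ∀ r, s ≤ r → 2 * h * F r ≤ G (r + h) - G (r - h)) (hh : 0 ≤ h) (n : ℕ) :
    ∑ j ∈ Finset.range n, 2 * h * F (s + j * (2 * h)) ≤ G (s + n * (2 * h) - h) - G (s - h) := by
  induction n with
  | zero => simp
  | succ n ih =>
    rw [Finset.sum_range_succ]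
    have h1 := hFG (s + n * (2 * h)) (le_add_of_nonneg_right (by positivity))
    have h2 : s + n * (2 * h) + h = s + (n + 1 : ℕ) * (2 * h) - h := by push_cast; ring
    rw [h2] at h1
    linarith

section Sums

variable {h δ : ℝ}

theorem sum_exp_le (hh : 0 < h) (hδ : 2 * h ≤ δ) (n : ℕ) :
    ∑ j ∈ Finset.range n, 2 * h * Real.exp (-(δ + j * (2 * h))) ≤
      Real.exp (-h) - Real.exp (-(δ + n * (2 * h) - h)) := by
  have h1 := sum_le_of_midpoint (F := fun s => Real.exp (-s)) (G := fun s => -Real.exp (-s))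
    (s := δ) (fun r _ => midpoint_exp hh.le r) hh.le n
  have h2 : Real.exp (-(δ - h)) ≤ Real.exp (-h) := Real.exp_le_exp.2 (by linarith)
  linarith

theorem sum_exp_sq_le (hh : 0 < h) (hδ : 2 * h ≤ δ) (n : ℕ) :
    ∑ j ∈ Finset.range n, 2 * h * Real.exp (-(δ + j * (2 * h))) ^ 2 ≤
      (Real.exp (-h) ^ 2 - Real.exp (-(δ + n * (2 * h) - h)) ^ 2) / 2 := by
  have hsq : ∀ s : ℝ, Real.exp (-s) ^ 2 = Real.exp (-(2 * s)) := by
    intro s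
    rw [← Real.exp_nat_mul]
    congr 1
    push_cast
    ring
  have h1 := sum_le_of_midpoint (F := fun s => Real.exp (-s) ^ 2)
    (G := fun s => -Real.exp (-s) ^ 2 / 2) (s := δ) (h := h) (fun r _ => by
      have h3 := midpoint_exp (h := 2 * h) (by linarith) (2 * r)
      simp only [hsq]
      rw [show 2 * (r + h) = 2 * r + 2 * h by ring, show 2 * (r - h) = 2 * r - 2 * h by ring]
      linarith) hh.le n
  have h2 : Real.exp (-(δ - h)) ^ 2 ≤ Real.exp (-h) ^ 2 :=
    pow_le_pow_left₀ (Real.exp_pos _).le (Real.exp_le_exp.2 (by linarith)) 2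
  linarith

/-- The midpoint rule is applied from the second term on. The first term, next to the singularity
at `0`, is bounded directly. -/
theorem sum_tail_le (hh : 0 < h) (hδ : 2 * h ≤ δ) (n : ℕ) :
    ∑ j ∈ Finset.range n, 2 * h * (Real.exp (-(δ + j * (2 * h))) ^ 2 /
      (1 - Real.exp (-(δ + j * (2 * h))))) ≤ -Real.log (1 - Real.exp (-h) ^ 3) := by
  have hy1 : Real.exp (-h) < 1 := Real.exp_lt_one_iff.2 (by linarith)
  have hy0 := Real.exp_pos (-h)
  have hy3 : Real.exp (-h) ^ 3 = Real.exp (-(3 * h)) := by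
    rw [← Real.exp_nat_mul]; congr 1; push_cast; ring
  cases n with
  | zero =>
    have h1 : Real.exp (-h) ^ 3 ≤ 1 := pow_le_one₀ hy0.le hy1.le
    have h2 : 0 ≤ Real.exp (-h) ^ 3 := by positivity
    simpa using Real.log_nonpos (by linarith) (by linarith)
  | succ n =>
    rw [Finset.sum_range_succ']
    have hrest := sum_le_of_midpoint
      (F := fun s => Real.exp (-s) ^ 2 / (1 - Real.exp (-s))) (G := tailPrim)
      (s := δ + 2 * h) (fun r hr => midpoint_tail hh (by linarith)) hh.le n
    have e1 : ∀ j : ℕ, δ + 2 * h + j * (2 * h) = δ + (j + 1 : ℕ) * (2 * h) := by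
      intro j; push_cast; ring
    simp only [e1] at hrest
    have h1 : tailPrim (δ + (n + 1 : ℕ) * (2 * h) - h) ≤ 0 :=
      tailPrim_nonpos (by push_cast; nlinarith [mul_nonneg n.cast_nonneg hh.le])
    have h2 : tailPrim (3 * h) ≤ tailPrim (δ + 2 * h - h) :=
      tailPrim_mono (by linarith) (by linarith)
    rw [tailPrim, ← hy3] at h2
    -- The first term is at most `e⁻³ʰ`, since `h ≤ sinh h`
    have h3 : 2 * h * (Real.exp (-(δ + (0 : ℕ) * (2 * h))) ^ 2 /
        (1 - Real.exp (-(δ + (0 : ℕ) * (2 * h))))) ≤ Real.exp (-h) ^ 3 := by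
      have hx : Real.exp (-(δ + (0 : ℕ) * (2 * h))) ≤ Real.exp (-h) ^ 2 := by
        rw [← Real.exp_nat_mul]
        refine Real.exp_le_exp.2 ?_
        push_cast
        linarith
      have hx0 := Real.exp_pos (-(δ + (0 : ℕ) * (2 * h)))
      set x := Real.exp (-(δ + (0 : ℕ) * (2 * h)))
      have hsinh := Real.self_le_sinh_iff.2 hh.le
      rw [Real.sinh_eq] at hsinh
      have hinv : Real.exp h * Real.exp (-h) = 1 := by rw [← Real.exp_add]; simp
      set y := Real.exp (-h)
      have hyy : y ^ 2 < 1 := by nlinarith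
      have hkey : 2 * h * y ≤ 1 - y ^ 2 := by nlinarith
      rw [← mul_div_assoc, div_le_iff₀ (by linarith)]
      have hx2 : x ^ 2 ≤ y ^ 2 * y ^ 2 := by nlinarith
      have s1 : 2 * h * x ^ 2 ≤ 2 * h * (y ^ 2 * y ^ 2) := by gcongr
      have s2 : y ^ 3 * (2 * h * y) ≤ y ^ 3 * (1 - y ^ 2) := by gcongr
      have s3 : y ^ 3 * (1 - y ^ 2) ≤ y ^ 3 * (1 - x) := by gcongr
      nlinarith
    linarith

end Sums

/-! ### Numerical bounds -/

theorem exp_neg_le_quadratic {t : ℝ} (ht : 0 ≤ t) : Real.exp (-t) ≤ 1 - t + t ^ 2 / 2 := by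
  have h := Real.sum_le_exp_of_nonneg ht 4
  simp only [Finset.sum_range_succ, Finset.sum_range_zero, Nat.factorial] at h
  norm_num at h
  have hinv : Real.exp t * Real.exp (-t) = 1 := by rw [← Real.exp_add]; simp
  have h0 : 0 < 1 - t + t ^ 2 / 2 := by nlinarith [sq_nonneg (t - 1)]
  have h1 : 1 ≤ Real.exp t * (1 - t + t ^ 2 / 2) := by
    have h2 := mul_le_mul_of_nonneg_right h h0.le
    nlinarith [pow_nonneg ht 3, pow_nonneg ht 4, pow_nonneg ht 5]
  have h2 : Real.exp t * Real.exp (-t) ≤ Real.exp t * (1 - t + t ^ 2 / 2) := hinv.trans_le h1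
  exact le_of_mul_le_mul_left h2 (Real.exp_pos t)

theorem abs_exp_neg_sub_cubic_le {t : ℝ} (h0 : 0 ≤ t) (h1 : t ≤ 1) :
    |Real.exp (-t) - (1 - t + t ^ 2 / 2 - t ^ 3 / 6)| ≤ t ^ 4 * (5 / 96) := by
  have h := Real.exp_bound (x := -t) (by rwa [abs_neg, abs_of_nonneg h0]) (n := 4) (by norm_num)
  rw [abs_neg, abs_of_nonneg h0] at h
  simp only [Finset.sum_range_succ, Finset.sum_range_zero, Nat.factorial] at h
  norm_num at h
  convert h using 2
  ring

/-- The tangent of the logarithm at `3 / 10`, which is tight enough in the whole range of the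
step length. -/
theorem neg_log_le {x : ℝ} (hx : 0 < x) : -Real.log x ≤ 206 / 1000 + 3 / 10 / x := by
  have h1 : Real.log (10 / 3) ≤ 1206 / 1000 := by
    -- `40 / 23` is a good upper approximation of the logarithm of `10 / 3` to the base `2`.
    have h2 : Real.log ((10 / 3) ^ 23) ≤ Real.log (2 ^ 40) :=
      Real.log_le_log (by norm_num) (by norm_num)
    rw [Real.log_pow, Real.log_pow] at h2
    have := Real.log_two_lt_d9
    norm_num at h2
    linarith
  have h2 := Real.log_le_sub_one_of_pos (x := 3 / 10 / x) (by positivity)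
  rw [Real.log_div (by norm_num) hx.ne'] at h2
  have h3 : Real.log (10 / 3) = -Real.log (3 / 10) := by
    rw [← Real.log_inv]; norm_num
  linarith

/-- A cubic lower bound of `(1 - e⁻³ᵘ) / u`, from the Taylor polynomial of the exponential. -/
def gapPoly (u : ℝ) : ℝ := 3 - 9 / 2 * u + 9 / 2 * u ^ 2 - 135 / 32 * u ^ 3

theorem gapPoly_pos {u : ℝ} (hu0 : 0 < u) (hu : u ≤ 1 / 4) : 0 < gapPoly u := by
  unfold gapPoly
  nlinarith [mul_pos hu0 hu0, mul_pos (mul_pos hu0 hu0) hu0,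
    mul_nonneg (mul_pos hu0 hu0).le (sub_nonneg.2 hu)]

theorem mul_gapPoly_le {u : ℝ} (hu0 : 0 < u) (hu : u ≤ 1 / 4) :
    u * gapPoly u ≤ 1 - Real.exp (-u) ^ 3 := by
  have h := (abs_le.1 (abs_exp_neg_sub_cubic_le (t := 3 * u) (by linarith) (by linarith))).2
  have h2 : Real.exp (-u) ^ 3 = Real.exp (-(3 * u)) := by
    rw [← Real.exp_nat_mul]; congr 1; push_cast; ring
  rw [h2, gapPoly]
  nlinarith

theorem neg_log_one_sub_exp_le {u : ℝ} (hu0 : 0 < u) (hu : u ≤ 1 / 4) :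
    -Real.log (1 - Real.exp (-u) ^ 3) ≤ 206 / 1000 + 3 / 10 / (u * gapPoly u) := by
  have h1 := mul_gapPoly_le hu0 hu
  have h2 := mul_pos hu0 (gapPoly_pos hu0 hu)
  refine (neg_log_le (h2.trans_le h1)).trans ?_
  gcongr

/-- The numerical inequality for `d = 1` and large `ε = 4 u`, where `m ≤ 1` suffices. The value
`147 / 1000` lies in the short interval where this inequality and `small_step_bound` both hold. -/
theorem large_step_bound {u X : ℝ} (hu0 : 147 / 1000 ≤ u) (hu : u ≤ 1 / 4)
    (hX : 4 * u ^ 2 * (1 + u) ≤ X) :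
    Real.exp (-u) - X - Real.log (1 - Real.exp (-u) ^ 3) ≤ 2 - 8 * u ^ 2 := by
  have hu' : 0 < u := by linarith
  have h1 := exp_neg_le_quadratic hu'.le
  have h2 := neg_log_one_sub_exp_le hu' hu
  have hg := gapPoly_pos hu' hu
  have h3 : 3 / 10 / (u * gapPoly u) ≤
      2 - 8 * u ^ 2 - (1 - u + u ^ 2 / 2 - 4 * u ^ 2 * (1 + u) + 206 / 1000) := by
    rw [div_le_iff₀ (mul_pos hu' hg)]
    unfold gapPoly
    obtain ⟨t, rfl⟩ : ∃ t, u = 147 / 1000 + t := ⟨u - 147 / 1000, by ring⟩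
    have ht0 : 0 ≤ t := by linarith
    have ht1 : t ≤ 103 / 1000 := by linarith
    nlinarith [pow_nonneg ht0 2, pow_nonneg ht0 3, pow_nonneg ht0 4, pow_nonneg ht0 5,
      pow_nonneg ht0 6, mul_nonneg ht0 (sub_nonneg.2 ht1),
      mul_nonneg (pow_nonneg ht0 2) (sub_nonneg.2 ht1),
      mul_nonneg (pow_nonneg ht0 3) (sub_nonneg.2 ht1),
      mul_nonneg (pow_nonneg ht0 4) (sub_nonneg.2 ht1),
      mul_nonneg (pow_nonneg ht0 5) (sub_nonneg.2 ht1),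
      mul_nonneg (pow_nonneg ht0 6) (sub_nonneg.2 ht1)]
  linarith

/-- The polynomial inequality behind `small_step_bound`. -/
theorem small_step_polynomial {u : ℝ} (hu0 : 0 < u) (hu : u ≤ 147 / 1000) :
    (4 * ((1 + 22 / 5 * u ^ 2) / 3 + 3 / 8) +
        (2 - 2 * u + 4 / 3 * u ^ 2 + 5 / 6 * u ^ 3) * (1 + 22 / 5 * u ^ 2)) *
        (206 / 1000 * u * gapPoly u + 3 / 10) / gapPoly u ≤
      2 - 8 * u ^ 2 - (1 - u + u ^ 2 / 2 - 4 * u ^ 2 * (1 + u)) -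
        (1 - 2 * u + 2 * u ^ 2) * (1 + 22 / 5 * u ^ 2) *
          ((1 - 2 * u + 2 * u ^ 2 - 16 * u ^ 4) / 2) := by
  have hg := gapPoly_pos hu0 (hu.trans (by norm_num))
  rw [div_le_iff₀ hg, ← sub_nonneg]
  unfold gapPoly
  have p1 : 0 ≤ 1 / 20 + 4363 / 1000 * u - 84867 / 2000 * u ^ 2 + 74 * u ^ 3 := by
    have := mul_nonneg (mul_nonneg hu0.le (sub_nonneg.2 hu))
      (show 0 ≤ 63111 / 2000 - 74 * u by linarith)
    linarith
  have p2 : 0 ≤ u ^ 3 * (22 - 148 * u) := mul_nonneg (by positivity) (by linarith)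
  have p3 : 0 ≤ u ^ 5 * (149 - 355 * u ^ 2) := mul_nonneg (by positivity) (by nlinarith)
  have p4 : 0 ≤ u ^ 8 * (713 - 810 * u) := mul_nonneg (by positivity) (by linarith)
  have p5 : 0 ≤ u ^ 10 * (613 - 297 * u) := mul_nonneg (by positivity) (by linarith)
  linarith [pow_pos hu0 3, pow_pos hu0 4, pow_pos hu0 5, pow_pos hu0 6, pow_pos hu0 7,
    pow_pos hu0 8, pow_pos hu0 9, pow_pos hu0 10]

/-- The numerical inequality for `d = 1` and small `ε = 4 u`. The left side is the bound of
`sum_le_of_le_affine` with `a = 1 - 4 u ^ 2`, and `X` stands for `e ^ (u - T)`. -/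
theorem small_step_bound {u X : ℝ} (hu0 : 0 < u) (hu : u ≤ 147 / 1000)
    (hX : 4 * u ^ 2 * (1 + u) ≤ X) :
    (4 * u * (1 / (3 * (1 - 4 * u ^ 2)) + 3 / 8) + (1 - Real.exp (-u) ^ 2) / (1 - 4 * u ^ 2)) *
        -Real.log (1 - Real.exp (-u) ^ 3) + (Real.exp (-u) - X) +
      Real.exp (-u) ^ 2 / (1 - 4 * u ^ 2) * ((Real.exp (-u) ^ 2 - X ^ 2) / 2) ≤ 2 - 8 * u ^ 2 := by
  have hy := exp_neg_le_quadratic hu0.le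
  have hsq : Real.exp (-u) ^ 2 = Real.exp (-(2 * u)) := by
    rw [← Real.exp_nat_mul]; congr 1; push_cast; ring
  have hc := exp_neg_le_quadratic (t := 2 * u) (by linarith)
  have hc' := (abs_le.1 (abs_exp_neg_sub_cubic_le (t := 2 * u) (by linarith) (by linarith))).1
  have hQ := neg_log_one_sub_exp_le hu0 (hu.trans (by norm_num))
  have hg := gapPoly_pos hu0 (hu.trans (by norm_num))
  rw [← hsq] at hc hc'
  have hy1 : Real.exp (-u) < 1 := Real.exp_lt_one_iff.2 (by linarith)
  have hlog0 : 0 ≤ -Real.log (1 - Real.exp (-u) ^ 3) := by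
    have := Real.exp_pos (-u)
    have h1 : Real.exp (-u) ^ 3 ≤ 1 := pow_le_one₀ this.le hy1.le
    exact neg_nonneg.2 (Real.log_nonpos (by linarith) (by linarith [pow_pos this 3]))
  have hc0 := sq_nonneg (Real.exp (-u))
  set Q := -Real.log (1 - Real.exp (-u) ^ 3)
  set c := Real.exp (-u) ^ 2
  have hu2 : u ^ 2 ≤ 147 / 1000 * u := by nlinarith
  have ha : 0 < 1 - 4 * u ^ 2 := by nlinarith
  have hinv : 1 / (1 - 4 * u ^ 2) ≤ 1 + 22 / 5 * u ^ 2 := by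
    rw [div_le_iff₀ ha]
    nlinarith [sq_nonneg u]
  have hinv0 : 0 < 1 / (1 - 4 * u ^ 2) := by positivity
  have e1 : 1 / (3 * (1 - 4 * u ^ 2)) = 1 / (1 - 4 * u ^ 2) / 3 := by
    field_simp
  rw [e1, div_eq_mul_one_div (1 - c), div_eq_mul_one_div c]
  set i := 1 / (1 - 4 * u ^ 2)
  have hX2 : 16 * u ^ 4 ≤ X ^ 2 := by
    have h1 : 4 * u ^ 2 ≤ X := le_trans (by nlinarith [pow_pos hu0 3]) hX
    calc 16 * u ^ 4 = (4 * u ^ 2) ^ 2 := by ring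
      _ ≤ X ^ 2 := pow_le_pow_left₀ (by positivity) h1 2
  have hc1 : 1 - c ≤ 2 * u - 2 * u ^ 2 + 4 / 3 * u ^ 3 + 5 / 6 * u ^ 4 := by nlinarith
  have hc2 : c ≤ 1 - 2 * u + 2 * u ^ 2 := by nlinarith
  have hw : 0 ≤ 1 - 2 * u + 2 * u ^ 2 := by nlinarith
  have hd0 : 0 ≤ 1 - 2 * u + 2 * u ^ 2 - 16 * u ^ 4 := by nlinarith [sq_nonneg u]
  have t1 : (4 * u * (i / 3 + 3 / 8) + (1 - c) * i) * Q ≤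
      (4 * u * ((1 + 22 / 5 * u ^ 2) / 3 + 3 / 8) +
        (2 * u - 2 * u ^ 2 + 4 / 3 * u ^ 3 + 5 / 6 * u ^ 4) * (1 + 22 / 5 * u ^ 2)) *
        (206 / 1000 + 3 / 10 / (u * gapPoly u)) := by
    have h4 : 0 ≤ 2 * u - 2 * u ^ 2 + 4 / 3 * u ^ 3 + 5 / 6 * u ^ 4 := by
      have := pow_pos hu0 3
      have := pow_pos hu0 4
      nlinarith
    gcongr
  have t2 : c * i * ((c - X ^ 2) / 2) ≤ (1 - 2 * u + 2 * u ^ 2) * (1 + 22 / 5 * u ^ 2) *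
      ((1 - 2 * u + 2 * u ^ 2 - 16 * u ^ 4) / 2) := by
    have h5 : (c - X ^ 2) / 2 ≤ (1 - 2 * u + 2 * u ^ 2 - 16 * u ^ 4) / 2 := by linarith
    calc c * i * ((c - X ^ 2) / 2)
        ≤ c * i * ((1 - 2 * u + 2 * u ^ 2 - 16 * u ^ 4) / 2) := by gcongr
      _ ≤ _ := by gcongr
  have e2 : (4 * u * ((1 + 22 / 5 * u ^ 2) / 3 + 3 / 8) +
        (2 * u - 2 * u ^ 2 + 4 / 3 * u ^ 3 + 5 / 6 * u ^ 4) * (1 + 22 / 5 * u ^ 2)) *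
        (206 / 1000 + 3 / 10 / (u * gapPoly u)) =
      (4 * ((1 + 22 / 5 * u ^ 2) / 3 + 3 / 8) +
        (2 - 2 * u + 4 / 3 * u ^ 2 + 5 / 6 * u ^ 3) * (1 + 22 / 5 * u ^ 2)) *
        (206 / 1000 * u * gapPoly u + 3 / 10) / gapPoly u := by
    field_simp
  have t3 := small_step_polynomial hu0 hu
  linarith

/-! ### The sum over the segments -/

theorem div_exp_sub_one {s : ℝ} (hs : 0 < s) (m : ℝ) :
    m / (Real.exp s - 1) = m * (Real.exp (-s) / (1 - Real.exp (-s))) := by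
  have h1 : Real.exp (-s) < 1 := Real.exp_lt_one_iff.2 (by linarith)
  have h2 : Real.exp s - 1 ≠ 0 := by linarith [Real.add_one_lt_exp hs.ne']
  have h3 : Real.exp s * Real.exp (-s) = 1 := by rw [← Real.exp_add]; simp
  have h4 : 1 - Real.exp (-s) ≠ 0 := by linarith
  field_simp
  linear_combination -m * h3

/-- The sum over the segments when only `m ≤ 1` is known. -/
theorem sum_le_of_le_one {u δ : ℝ} (hu : 0 < u) (hδ : 2 * u ≤ δ) (n : ℕ) {m : ℕ → ℝ}
    (hm : ∀ j < n, m j ≤ 1) :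
    ∑ j ∈ Finset.range n, 2 * u * (m j / (Real.exp (δ + j * (2 * u)) - 1)) ≤
      Real.exp (-u) - Real.exp (-(δ + n * (2 * u) - u)) - Real.log (1 - Real.exp (-u) ^ 3) := by
  have h1 := sum_exp_le hu hδ n
  have h2 := sum_tail_le hu hδ n
  have h3 : ∑ j ∈ Finset.range n, 2 * u * (m j / (Real.exp (δ + j * (2 * u)) - 1)) ≤
      ∑ j ∈ Finset.range n, (2 * u * Real.exp (-(δ + j * (2 * u))) +
        2 * u * (Real.exp (-(δ + j * (2 * u))) ^ 2 / (1 - Real.exp (-(δ + j * (2 * u)))))) := by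
    refine Finset.sum_le_sum fun j hj => ?_
    have hδ0 : 0 < δ := by linarith
    have hs : 0 < δ + j * (2 * u) := by positivity
    have hx1 : Real.exp (-(δ + j * (2 * u))) < 1 := Real.exp_lt_one_iff.2 (by linarith)
    have hx0 := Real.exp_pos (-(δ + j * (2 * u)))
    rw [div_exp_sub_one hs, ← mul_add]
    have hmj := hm j (Finset.mem_range.1 hj)
    set x := Real.exp (-(δ + j * (2 * u)))
    have hx1' : 0 < 1 - x := by linarith
    have e : x + x ^ 2 / (1 - x) = 1 * (x / (1 - x)) := by field_simp; ring
    rw [e]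
    gcongr
  rw [Finset.sum_add_distrib] at h3
  linarith

/-- With `x = e⁻ˢ` at the remaining time `s`, the bounds `m ≤ 1` and `m ≤ (1 - e⁻²ᵘ x) / a + κ` are
averaged with the weights `1 - x` and `x`. The second one is the better one near the end of the time
interval, where `x` is close to `1`, and these weights make the sums explicit. -/
theorem sum_le_of_le_affine {u δ a κ : ℝ} (hu : 0 < u) (hδ : 2 * u ≤ δ) (ha : 0 < a) (hκ : 0 ≤ κ)
    (n : ℕ) {m : ℕ → ℝ} (hm : ∀ j < n, m j ≤ 1)
    (hm' : ∀ j < n, m j ≤ (1 - Real.exp (-(δ + j * (2 * u) + 2 * u))) / a + κ) :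
    ∑ j ∈ Finset.range n, 2 * u * (m j / (Real.exp (δ + j * (2 * u)) - 1)) ≤
      (κ + (1 - Real.exp (-u) ^ 2) / a) * -Real.log (1 - Real.exp (-u) ^ 3) +
        (Real.exp (-u) - Real.exp (-(δ + n * (2 * u) - u))) +
        Real.exp (-u) ^ 2 / a *
          ((Real.exp (-u) ^ 2 - Real.exp (-(δ + n * (2 * u) - u)) ^ 2) / 2) := by
  have h1 := sum_exp_le hu hδ n
  have h2 := sum_tail_le hu hδ n
  have h4 := sum_exp_sq_le hu hδ n
  have hc1 : Real.exp (-u) ^ 2 ≤ 1 :=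
    pow_le_one₀ (Real.exp_pos _).le (Real.exp_le_one_iff.2 (by linarith))
  have hc : ∀ s : ℝ, Real.exp (-(s + 2 * u)) = Real.exp (-u) ^ 2 * Real.exp (-s) := by
    intro s
    rw [← Real.exp_nat_mul, ← Real.exp_add]
    congr 1
    push_cast
    ring
  simp only [hc] at hm'
  set c := Real.exp (-u) ^ 2
  have hc0 : 0 ≤ c := sq_nonneg _
  have h3 : ∑ j ∈ Finset.range n, 2 * u * (m j / (Real.exp (δ + j * (2 * u)) - 1)) ≤
      ∑ j ∈ Finset.range n, ((κ + (1 - c) / a) * (2 * u * (Real.exp (-(δ + j * (2 * u))) ^ 2 /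
          (1 - Real.exp (-(δ + j * (2 * u)))))) +
        2 * u * Real.exp (-(δ + j * (2 * u))) +
        c / a * (2 * u * Real.exp (-(δ + j * (2 * u))) ^ 2)) := by
    refine Finset.sum_le_sum fun j hj => ?_
    have hδ0 : 0 < δ := by linarith
    have hs : 0 < δ + j * (2 * u) := by positivity
    have hx1 : Real.exp (-(δ + j * (2 * u))) < 1 := Real.exp_lt_one_iff.2 (by linarith)
    have hx0 := Real.exp_pos (-(δ + j * (2 * u)))
    rw [div_exp_sub_one hs]
    have hmj := hm j (Finset.mem_range.1 hj)
    have hmj' := hm' j (Finset.mem_range.1 hj)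
    set x := Real.exp (-(δ + j * (2 * u)))
    have hx1' : 0 < 1 - x := by linarith
    have hmx : m j ≤ x * ((1 - c * x) / a + κ) + (1 - x) := by nlinarith
    have e : (κ + (1 - c) / a) * (2 * u * (x ^ 2 / (1 - x))) + 2 * u * x +
        c / a * (2 * u * x ^ 2) =
        2 * u * ((x * ((1 - c * x) / a + κ) + (1 - x)) * (x / (1 - x))) := by
      field_simp
      ring
    rw [e]
    gcongr
  rw [Finset.sum_add_distrib, Finset.sum_add_distrib,
    ← Finset.mul_sum _ _ (κ + (1 - c) / a), ← Finset.mul_sum _ _ (c / a)] at h3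
  have h5 : 0 ≤ κ + (1 - c) / a := add_nonneg hκ (div_nonneg (by linarith) ha.le)
  have h6 := mul_le_mul_of_nonneg_left h2 h5
  have h7 := mul_le_mul_of_nonneg_left h4 (div_nonneg hc0 ha.le)
  linarith

/-- The bound of the number of evaluations for `d = 1`, with `ε = 4 u`. The terms are indexed
backwards in time: term `j` belongs to the segment ending at `T - δ - 2 u j`. -/
theorem sum_le_of_dim_one {u δ : ℝ} (hu : 0 < u) (hu1 : u ≤ 1 / 4) (hδ : 2 * u ≤ δ) (n : ℕ)
    (hn : Real.exp (-(δ + n * (2 * u))) = 4 * u ^ 2) {m : ℕ → ℝ} (hm : ∀ j < n, m j ≤ 1)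
    (hm' : ∀ j < n, m j ≤ (1 - Real.exp (-(δ + j * (2 * u) + 2 * u))) / (1 - 4 * u ^ 2) +
      4 * u * (1 / (3 * (1 - 4 * u ^ 2)) + 3 / 8)) :
    ∑ j ∈ Finset.range n, 2 * u * (m j / (Real.exp (δ + j * (2 * u)) - 1)) ≤ 2 - 8 * u ^ 2 := by
  have hX : 4 * u ^ 2 * (1 + u) ≤ Real.exp (-(δ + n * (2 * u) - u)) := by
    have : Real.exp (-(δ + n * (2 * u) - u)) = 4 * u ^ 2 * Real.exp u := by
      rw [← hn, ← Real.exp_add]; congr 1; ring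
    rw [this]
    have := Real.add_one_le_exp u
    gcongr
    linarith
  have ha : 0 < 1 - 4 * u ^ 2 := by nlinarith
  rcases le_total u (147 / 1000) with h | h
  · exact (sum_le_of_le_affine hu hδ ha (by positivity) n hm hm').trans (small_step_bound hu h hX)
  · exact (sum_le_of_le_one hu hδ n hm).trans (large_step_bound h hu1 hX)

/-- The bound of the number of evaluations for `d ≥ 2`, per token and coordinate, with the terms
indexed backwards in time. -/
theorem sum_le_of_two_le_dim {ε δ d : ℝ} (hε : 0 < ε) (hε1 : ε < 1) (hd : 2 ≤ d)
    (hδ : ε / (2 * d) ≤ δ) (n : ℕ) {m : ℕ → ℝ}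
    (hm : ∀ j < n, m j ≤ 1 - Real.exp (-(δ + j * (ε / (2 * d)) + ε / (2 * d))) + ε) :
    ∑ j ∈ Finset.range n, ε / (2 * d) * (m j / (Real.exp (δ + j * (ε / (2 * d))) - 1)) ≤
      2 - ε ^ 2 / (2 * d) + 12 * Real.log d := by
  have hd0 : 0 < d := by linarith
  obtain ⟨u, hu⟩ : ∃ u, u = ε / (4 * d) := ⟨_, rfl⟩
  have hu2 : ε / (2 * d) = 2 * u := by rw [hu]; field_simp; norm_num
  have hu0 : 0 < u := by rw [hu]; positivity
  have hud : u * (4 * d) = ε := by rw [hu]; field_simp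
  have hu8 : 2 * u ≤ ε / 4 := by nlinarith
  rw [hu2] at hδ
  simp only [hu2] at hm ⊢
  have h1 := sum_exp_le hu0 hδ n
  have h2 := sum_tail_le hu0 hδ n
  have hy1 : Real.exp (-u) ≤ 1 := Real.exp_le_one_iff.2 (by linarith)
  have hX := Real.exp_pos (-(δ + n * (2 * u) - u))
  have h3 : ∑ j ∈ Finset.range n, 2 * u * (m j / (Real.exp (δ + j * (2 * u)) - 1)) ≤
      ∑ j ∈ Finset.range n, ((1 + 2 * u + ε) * (2 * u * Real.exp (-(δ + j * (2 * u)))) +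
        (2 * u + ε) * (2 * u * (Real.exp (-(δ + j * (2 * u))) ^ 2 /
          (1 - Real.exp (-(δ + j * (2 * u))))))) := by
    refine Finset.sum_le_sum fun j hj => ?_
    have hδ0 : 0 < δ := by linarith
    have hs : 0 < δ + j * (2 * u) := by positivity
    have hx1 : Real.exp (-(δ + j * (2 * u))) < 1 := Real.exp_lt_one_iff.2 (by linarith)
    have hx0 := Real.exp_pos (-(δ + j * (2 * u)))
    rw [div_exp_sub_one hs]
    have hmj := hm j (Finset.mem_range.1 hj)
    have hexp : Real.exp (-(δ + j * (2 * u) + 2 * u)) =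
        Real.exp (-(δ + j * (2 * u))) * Real.exp (-(2 * u)) := by
      rw [← Real.exp_add]; congr 1; ring
    have hc := Real.add_one_le_exp (-(2 * u))
    rw [hexp] at hmj
    set x := Real.exp (-(δ + j * (2 * u)))
    have hx1' : 0 < 1 - x := by linarith
    have hmx : m j ≤ (1 - x) + (2 * u + ε) := by nlinarith
    have e : (1 + 2 * u + ε) * (2 * u * x) + (2 * u + ε) * (2 * u * (x ^ 2 / (1 - x))) =
        2 * u * (((1 - x) + (2 * u + ε)) * (x / (1 - x))) := by
      field_simp
      ring
    rw [e]
    gcongr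
  rw [Finset.sum_add_distrib, ← Finset.mul_sum _ _ (1 + 2 * u + ε),
    ← Finset.mul_sum _ _ (2 * u + ε)] at h3
  -- `1 - e⁻³ᵘ ≥ 2 u`, so the logarithm is at most `log (2 d / ε)`.
  have hlog : -Real.log (1 - Real.exp (-u) ^ 3) ≤ Real.log 2 + Real.log d - Real.log ε := by
    have hg := mul_gapPoly_le hu0 (by linarith)
    have h4 : 2 * u ≤ 1 - Real.exp (-u) ^ 3 := by
      refine le_trans ?_ hg
      unfold gapPoly
      have hu18 : u ≤ 1 / 8 := by linarith
      nlinarith [mul_nonneg hu0.le (sub_nonneg.2 hu18), mul_pos hu0 hu0,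
        mul_nonneg (mul_pos hu0 hu0).le (sub_nonneg.2 hu18), pow_pos hu0 3, pow_pos hu0 4,
        mul_nonneg (pow_pos hu0 3).le (sub_nonneg.2 hu18)]
    have h5 := Real.log_le_log (by linarith) h4
    have h6 : Real.log (2 * u) = Real.log ε - (Real.log 2 + Real.log d) := by
      rw [← Real.log_mul (by norm_num) hd0.ne', ← Real.log_div hε.ne' (by positivity), hu2]
    linarith
  have hεlog : -(ε * Real.log ε) ≤ 1 := by
    have h4 := Real.log_le_sub_one_of_pos (x := ε⁻¹) (inv_pos.2 hε)
    rw [Real.log_inv] at h4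
    have h5 := mul_le_mul_of_nonneg_left h4 hε.le
    rw [mul_sub, mul_inv_cancel₀ hε.ne'] at h5
    linarith
  have hlogε : Real.log ε ≤ 0 := Real.log_nonpos hε.le hε1.le
  have hlogd : Real.log 2 ≤ Real.log d := Real.log_le_log (by norm_num) hd
  have hl1 := Real.log_two_gt_d9
  have hl2 := Real.log_two_lt_d9
  have hS1 : ∑ j ∈ Finset.range n, 2 * u * Real.exp (-(δ + j * (2 * u))) ≤ 1 := by linarith
  have hQ := h2.trans hlog
  have hη : 0 ≤ 2 * u + ε := by linarith
  have t1 := mul_le_mul_of_nonneg_left hS1 (show 0 ≤ 1 + 2 * u + ε by linarith)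
  have t2 := mul_le_mul_of_nonneg_left hQ hη
  have t3 : (2 * u + ε) * (Real.log 2 + Real.log d - Real.log ε) ≤
      5 / 4 * ε * (Real.log 2 + Real.log d - Real.log ε) := by
    refine mul_le_mul_of_nonneg_right (by linarith) (by linarith)
  have t4 : ε * (Real.log 2 + Real.log d) ≤ Real.log 2 + Real.log d :=
    mul_le_of_le_one_left (by linarith) hε1.le
  have t5 : ε ^ 2 / (2 * d) ≤ 1 / 4 := by
    rw [div_le_iff₀ (by positivity)]
    nlinarith
  linarith

/-! ### Total variation -/

/-- On a finite type, the total variation distance is attained by a test function with values in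
`[0, 1]`. -/
theorem tvDist_le {α : Type*} [Fintype α] [MeasurableSpace α] [MeasurableSingletonClass α]
    (μ ν : Measure α) [IsProbabilityMeasure μ] [IsProbabilityMeasure ν] {C : ℝ}
    (h : ∀ g : α → ℝ, (∀ x, 0 ≤ g x) → (∀ x, g x ≤ 1) →
      ∑ x, μ.real {x} * g x ≤ ∑ x, ν.real {x} * g x + C) : tvDist μ ν ≤ C := by
  classical
  have hμ : ∑ x, μ.real {x} = 1 := by simp
  have hν : ∑ x, ν.real {x} = 1 := by simp
  have hg := h (fun x => if ν.real {x} ≤ μ.real {x} then 1 else 0)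
    (fun x => by split_ifs <;> norm_num) (fun x => by split_ifs <;> norm_num)
  have key : ∀ x, |μ.real {x} - ν.real {x}| =
      2 * (μ.real {x} * (if ν.real {x} ≤ μ.real {x} then 1 else 0)) -
        2 * (ν.real {x} * (if ν.real {x} ≤ μ.real {x} then 1 else 0)) -
        (μ.real {x} - ν.real {x}) := by
    intro x
    split_ifs with hx
    · rw [abs_of_nonneg (by linarith)]; ring
    · rw [abs_of_nonpos (by linarith)]; ring
  rw [tvDist, Finset.sum_congr rfl fun x _ => key x, Finset.sum_sub_distrib,
    Finset.sum_sub_distrib, Finset.sum_sub_distrib, ← Finset.mul_sum, ← Finset.mul_sum, hμ, hν]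
  linarith

/-- Early stopping: the target differs from its noised version at time `s` by at most `d s`. -/
theorem sum_target_mul_le (q : PMF (Seq K d)) (hq : ∀ y, q y ≠ 0 → numMask y = 0) {s : ℝ}
    (hs : 0 ≤ s) {g : Seq K d → ℝ} (hg0 : ∀ y, 0 ≤ g y) (hg1 : ∀ y, g y ≤ 1) :
    ∑ x, (q x).toReal * g x ≤ ∑ x, fwdMarginal q s x * g x + d * s := by
  have hexp := Real.add_one_le_exp (-(d * s))
  have h : ∀ x, (q x).toReal * g x ≤ fwdMarginal q s x * g x + d * s * (q x).toReal := by
    intro x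
    have h1 := le_fwdMarginal q hq hs x
    have hq0 : 0 ≤ (q x).toReal := ENNReal.toReal_nonneg
    have h2 := mul_le_mul_of_nonneg_right h1 (hg0 x)
    have h3 : 0 ≤ d * s * (q x).toReal := by positivity
    have h4 := mul_le_mul_of_nonneg_right hexp hq0
    nlinarith [mul_le_mul_of_nonneg_left (hg1 x) h3, mul_le_mul_of_nonneg_right h4 (hg0 x)]
  refine (Finset.sum_le_sum fun x _ => h x).trans ?_
  rw [Finset.sum_add_distrib, ← Finset.mul_sum, sum_toReal_pmf, mul_one]

theorem sum_fwdMarginal_mul_maskFrac (q : PMF (Seq K d)) (hq : ∀ y, q y ≠ 0 → numMask y = 0)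
    (hd : d ≠ 0) (s : ℝ) :
    ∑ x, fwdMarginal q s x * ((numMask x : ℝ) / d) = 1 - Real.exp (-s) := by
  have hd' : (d : ℝ) ≠ 0 := Nat.cast_ne_zero.2 hd
  simp_rw [← mul_div_assoc]
  rw [← Finset.sum_div, sum_fwdMarginal_mul_numMask q hq, mul_div_cancel_left₀ _ hd']

theorem one_sub_le_fwdMarginal_mask (q : PMF (Seq K d)) (hq : ∀ y, q y ≠ 0 → numMask y = 0)
    {s : ℝ} (hs : 0 ≤ s) :
    1 - d * Real.exp (-s) ≤ fwdMarginal q s (fun _ => mask K) := by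
  rw [fwdMarginal_mask q hq]
  have h1 : Real.exp (-s) ≤ 1 := Real.exp_le_one_iff.2 (by linarith)
  have h := one_add_mul_le_pow (a := -Real.exp (-s)) (by linarith) d
  simpa [sub_eq_add_neg] using h

end MATU

end

theorem theorem2 (K d W : ℕ) [NeZero K] (hd : 1 ≤ d)
    -- the target distribution, without mask tokens
    (q : PMF (MATU.Seq K d)) (hq : ∀ y, q y ≠ 0 → MATU.numMask y = 0)
    -- the parameters
    (ε εscore T δ η : ℝ) (hε : 0 < ε) (hε1 : ε < 1)
    (hT : T = Real.log (4 * d / ε ^ 2))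
    (hδ : δ ≤ (d : ℝ)⁻¹ * ε)
    (hεscore0 : 0 ≤ εscore) (hεscore : εscore ≤ T ^ (-(1 / 2) : ℝ) * ε)
    -- the partition of `[0, T - δ]` into `W` segments of length `η`
    (hη : η = ε / (2 * d)) (hηδ : η ≤ δ)
    (p : ℕ → ℝ) (hp0 : p 0 = 0) (hpW : p W = T - δ)
    (hp : ∀ w, w < W → p (w + 1) - p w = η)
    -- the estimated score
    (v : ℝ → MATU.Seq K d → MATU.Seq K d → NNReal)
    (hv : ∀ y' y, Measurable fun t => v t y' y)
    (hSE : MATU.scoreEntropy q T v ≤ ENNReal.ofReal (εscore ^ 2)) :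
    MeasureTheory.IsProbabilityMeasure (MATU.samplerLaw v T p W) ∧
    MATU.tvDist q.toMeasure ((MATU.samplerLaw v T p W).map Prod.fst) ≤ 2 * ε ∧
    ∫⁻ x, (x.2 : ENNReal) ∂(MATU.samplerLaw v T p W) ≤
      ENNReal.ofReal (2 * K * (d - ε ^ 2 / 4) + 12 * K * d * Real.log d) := by
  have hd0 : (0 : ℝ) < d := by exact_mod_cast hd
  have hd1 : (1 : ℝ) ≤ d := by exact_mod_cast hd
  have hη0 : 0 < η := by rw [hη]; positivity
  have hδ0 : 0 < δ := hη0.trans_le hηδ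
  have hlt : ∀ i < W, p i < p (i + 1) := fun i hi => by linarith [hp i hi]
  have hpi : ∀ i ≤ W, p i = i * η := by
    intro i
    induction i with
    | zero => intro _; simp [hp0]
    | succ i ih =>
      intro hi
      have h1 := hp i hi
      have h2 := ih (Nat.le_of_succ_le hi)
      push_cast
      linarith
  have hTW : T = δ + W * η := by linarith [hpi W le_rfl]
  have hT0 : 0 < T := by rw [hTW]; positivity
  have hpT : ∀ i ≤ W, p i < T := fun i hi => by
    linarith [MATU.partition_le hlt hi]
  have hexpT : Real.exp (-T) = ε ^ 2 / (4 * d) := by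
    rw [hT, Real.exp_neg, Real.exp_log (by positivity), inv_div]
  have ha : 1 - ε ^ 2 / 4 ≤ MATU.fwdMarginal q T (fun _ => MATU.mask K) := by
    refine le_trans (le_of_eq ?_) (MATU.one_sub_le_fwdMarginal_mask q hq hT0.le)
    rw [hexpT]
    field_simp
  have hloss : ENNReal.ofReal T * MATU.scoreEntropy q T v ≤ ENNReal.ofReal (ε ^ 2) := by
    refine (mul_le_mul_right hSE _).trans ?_
    rw [← ENNReal.ofReal_mul hT0.le]
    refine ENNReal.ofReal_le_ofReal ?_
    have h1 : εscore ^ 2 ≤ (T ^ (-(1 / 2) : ℝ) * ε) ^ 2 := pow_le_pow_left₀ hεscore0 hεscore 2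
    have h2 : (T ^ (-(1 / 2) : ℝ)) ^ 2 = T⁻¹ := by
      rw [← Real.rpow_natCast, ← Real.rpow_mul hT0.le]
      norm_num [Real.rpow_neg_one]
    rw [mul_pow, h2] at h1
    calc T * εscore ^ 2 ≤ T * (T⁻¹ * ε ^ 2) := by gcongr
      _ = ε ^ 2 := by field_simp
  have hprob := MATU.isProbabilityMeasure_samplerLaw hv T p
  have hprobW := hprob W hlt
  -- The parameter `3 ε` of the exponential test functions nearly minimizes the error.
  have hgap : ∀ i ≤ W, ∀ g : MATU.Seq K d → ℝ, (∀ y, 0 ≤ g y) → (∀ y, g y ≤ 1) →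
      ∑ x, MATU.fwdMarginal q (T - p i) x * g x ≤
        (∫ x, g x.1 ∂(MATU.samplerLaw v T p i)) + ε := by
    intro i hi g hg0 hg1
    refine (MATU.sum_fwdMarginal_mul_le q hq hv (sq_nonneg ε) hloss p i
      (fun j hj => hlt j (hj.trans_le hi)) (hpT i hi) hp0 hT0 hg0 hg1
      (show 0 < 3 * ε by positivity)).trans ?_
    have h1 : ε ^ 2 / (3 * ε) = ε / 3 := by field_simp
    rw [h1]
    nlinarith
  refine ⟨hprobW, ?_, ?_⟩
  · have : MeasureTheory.IsProbabilityMeasure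
        ((MATU.samplerLaw v T p W).map Prod.fst) :=
      MeasureTheory.Measure.isProbabilityMeasure_map Measurable.of_discrete.aemeasurable
    refine MATU.tvDist_le _ _ fun g hg0 hg1 => ?_
    have h1 : ∑ x, q.toMeasure.real {x} * g x = ∑ x, (q x).toReal * g x := by
      refine Finset.sum_congr rfl fun x _ => ?_
      rw [MeasureTheory.measureReal_def,
        PMF.toMeasure_apply_singleton _ _ (MeasurableSet.singleton x)]
    have h2 : ∫ x, g x.1 ∂(MATU.samplerLaw v T p W) =
        ∑ x, ((MATU.samplerLaw v T p W).map Prod.fst).real {x} * g x := by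
      rw [← MeasureTheory.integral_map (φ := Prod.fst) (f := g)
        Measurable.of_discrete.aemeasurable Measurable.of_discrete.aestronglyMeasurable,
        MeasureTheory.integral_fintype .of_finite]
      simp
    have h3 := hgap W le_rfl g hg0 hg1
    rw [hpW, sub_sub_cancel, h2] at h3
    have h4 := MATU.sum_target_mul_le q hq hδ0.le hg0 hg1
    have h5 : d * δ ≤ ε := by
      have := mul_le_mul_of_nonneg_left hδ hd0.le
      rwa [← mul_assoc, mul_inv_cancel₀ hd0.ne', one_mul] at this
    rw [h1]
    linarith
  · rw [MATU.lintegral_samplerLaw_snd hv (by omega) T p W hlt (hpT W le_rfl), ← Finset.mul_sum,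
      ← Finset.sum_range_reflect]
    refine ENNReal.ofReal_le_ofReal ?_
    have hidx : ∀ j < W, T - p (W - 1 - j + 1) = δ + j * η ∧
        T - p (W - 1 - j) = δ + j * η + η := by
      intro j hj
      obtain ⟨k, hk⟩ : ∃ k, W = k + j + 1 := ⟨W - 1 - j, by omega⟩
      have h1 : W - 1 - j = k := by omega
      rw [h1, hpi _ (by omega), hpi _ (by omega), hTW, hk]
      push_cast
      constructor <;> ring
    have hsum : ∑ j ∈ Finset.range W, (p (W - 1 - j + 1) - p (W - 1 - j)) *
        (MATU.maskFrac v T p (W - 1 - j) / (Real.exp (T - p (W - 1 - j + 1)) - 1)) =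
        ∑ j ∈ Finset.range W, η *
          (MATU.maskFrac v T p (W - 1 - j) / (Real.exp (δ + j * η) - 1)) := by
      refine Finset.sum_congr rfl fun j hj => ?_
      have hj' := Finset.mem_range.1 hj
      rw [hp _ (by omega), (hidx j hj').1]
    rw [hsum]
    have hfrac := MATU.sum_fwdMarginal_mul_maskFrac q hq (Nat.one_le_iff_ne_zero.1 hd)
    rcases hd.eq_or_lt with h1 | h2
    · have hd1' : (d : ℝ) = 1 := by exact_mod_cast h1.symm
      have hη2 : η = 2 * (ε / 4) := by rw [hη, hd1']; ring
      have ha0 : 0 < 1 - ε ^ 2 / 4 := by nlinarith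
      have h4 : 4 * (ε / 4) ^ 2 = ε ^ 2 / 4 := by ring
      have hmain := MATU.sum_le_of_dim_one (u := ε / 4) (δ := δ) (by positivity) (by linarith)
        (by linarith) W (by rw [← hη2, ← hTW, hexpT, hd1']; ring)
        (m := fun j => MATU.maskFrac v T p (W - 1 - j))
        (fun j hj => MATU.maskFrac_le_one hv T p _ fun i hi => hlt i (by omega)) (by
          intro j hj
          have h := MATU.integral_samplerLaw_le q hq hv (sq_nonneg ε) hloss p (W - 1 - j)
            (fun i hi => hlt i (by omega)) (hpT _ (by omega)) hp0 hT0
            (g := fun y => (MATU.numMask y : ℝ) / d) (fun y => by positivity)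
            MATU.numMask_div_le_one (show 0 < 3 * ε by positivity) ha0 ha
          rw [hfrac, (hidx j hj).2] at h
          rw [← hη2, h4]
          refine h.trans (le_of_eq ?_)
          field_simp
          ring)
      rw [← hη2] at hmain
      rw [hd1', Real.log_one]
      have := mul_le_mul_of_nonneg_left hmain (Nat.cast_nonneg (α := ℝ) K)
      nlinarith
    · have hd2 : (2 : ℝ) ≤ d := by exact_mod_cast h2
      have hmain := MATU.sum_le_of_two_le_dim hε hε1 hd2 (δ := δ) (hη ▸ hηδ) W
        (m := fun j => MATU.maskFrac v T p (W - 1 - j)) (by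
          intro j hj
          have := hprob (W - 1 - j) fun i hi => hlt i (by omega)
          have h := hgap (W - 1 - j) (by omega) (fun y => 1 - (MATU.numMask y : ℝ) / d)
            (fun y => sub_nonneg.2 (MATU.numMask_div_le_one y))
            (fun y => sub_le_self _ (by positivity))
          simp_rw [mul_sub, mul_one] at h
          rw [Finset.sum_sub_distrib, hfrac, MATU.sum_fwdMarginal, (hidx j hj).2,
            MeasureTheory.integral_sub (MeasureTheory.integrable_const _)
              (MATU.integrable_fst fun y => (MATU.numMask y : ℝ) / d)] at h
          simp only [MeasureTheory.integral_const, MeasureTheory.probReal_univ, smul_eq_mul,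
            mul_one] at h
          rw [← hη, MATU.maskFrac]
          linarith)
      rw [← hη] at hmain
      have := mul_le_mul_of_nonneg_left hmain (by positivity : (0 : ℝ) ≤ K * d)
      refine this.trans (le_of_eq ?_)
      field_simp
      ring
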